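/- **Setting.** Let $t_f,\alpha,h>0$, let $M_p:\mathbb R^n\to\mathbb R^n$ be (everywhere defined, single-valued and) maximally monotone, let $B_p,B\in\mathbb R^{n\times m}$, $A\in\mathbb R^{n\times n}$, $x_{\mathrm{ref}}\in\mathbb R^n$, let $U\subset\mathbb R^m$ be closed and convex, $u_{\mathrm{ref}}\in U$, and let $F=\{u\in L^2(0,t_f;\mathbb R^m): u(t)\in U \text{ for a.e. } t\}$. $P_U$ and $P_F$ denote the metric projections in $\mathbb R^m$ and in $L^2(0,t_f;\mathbb R^m)$. A point value such as $x(0)$ of an $L^2$-class is that of its continuous representative on $[0,t_f]$. A strong solution of an ODE is a function that is Lipschitz on compact time intervals, is differentiable almost everywhere, and satisfies the equation almost everywhere. *MPC algorithm.* Given $x_{p,0}\in\mathbb R^n$, for $i=0,1,2,\dots$: (a) let $(x_i^\star,u_i^\star)$ be a solution of $$\min_{(x,u)}\int_0^{t_f}\Big(\tfrac12\|x-x_{\mathrm{ref}}\|^2+\tfrac\alpha2\|u-u_{\mathrm{ref}}\|^2\Big)d\tau\quad\text{s.t. } x\in H^1(0,t_f;\mathbb R^n),\ \dot x=Ax+Bu,\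 x(0)=x_{p,i},\ u\in F;$$ (b) put $u_{p,i}=u_i^\star(0)$; (c) put $x_{p,i+1}=x_p(h)$, where $\dot x_p=-M_p(x_p)+B_pu_{p,i}$ on $[0,h]$, $x_p(0)=x_{p,i}$. *Splitting scheme.* Let $W=L^2(0,t_f;\mathbb R^n)\times L^2(0,t_f;\mathbb R^n)\times\mathbb R^n$ and $V=\mathbb R^n\times W$. For $x_0\in\mathbb R^n$, the operator $M_{\mathrm{opt},x_0}$ on $W$ with domain $\{(x,\lambda,\lambda_0): x,\lambda\in H^1(0,t_f;\mathbb R^n),\ \lambda(0)=\lambda_0,\ \lambda(t_f)=0\}$ is $$M_{\mathrm{opt},x_0}(x,\lambda,\lambda_0)=\Big(x-x_{\mathrm{ref}}-\dot\lambda-A^*\lambda,\ -(\dot x-Ax)+BP_F(\tfrac1\alpha B^*\lambda+u_{\mathrm{ref}}),\ -x(0)+x_0\Big).$$ Let $F_1(x_p,(x,\lambda,\lambda_0))=\big(-M_p(x_p)+B_pP_U(\tfrac1\alpha B^*\lambda_0+u_{\mathrm{ref}}),\,0\big)$ on $V$, let $\varphi^1_t$ be the flow of strong solutions of $\dot v=F_1(v)$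 on $[0,\infty)$, and let $$r(x_p,w)=\big(x_p,\ M_{\mathrm{opt},0}^{-1}(0,0,-x_p)\big).$$ Call $v=(x_p,w)\in V$ *consistent* if $M_{\mathrm{opt},x_p}(w)=0$, i.e. if $v$ satisfies the algebraic constraint of the differential-algebraic ($\varepsilon=0$) coupled system $$\dot x_p=-M_p(x_p)+B_pP_U(\tfrac1\alpha B^*\lambda_0+u_{\mathrm{ref}}),\qquad 0=-M_{\mathrm{opt},0}(w)-(0,0,x_p).$$ **Theorem.** The flow $\varphi^1_t$ exists and is unique, and for each $x_0\in\mathbb R^n$ there is exactly one $w\in W$ with $M_{\mathrm{opt},0}(w)=(0,0,-x_0)$, so that $r$ is well defined. Let $(v_k)_{k\ge0}$, $v_k=(x_{p,k},(x_k,\lambda_k,\lambda_{0,k}))$, be generated by $$v_{k+1}=r\circ\varphi_h^1(v_k).$$ Then $v_{k+1}$ is consistent for all $k\ge0$, for any $v_0\in V$. If $v_0$ is consistent, then $(v_k)$ coincides with the sequence produced by the MPC algorithm from $x_{p,0}$: the MPC algorithm can be carried out, its result is unique, and for all $k$ its plant state is $x_{p,k}$, its optimal state is $x_k^\star=x_k$,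 its optimal control is $u_k^\star=P_F(\tfrac1\alpha B^*\lambda_k+u_{\mathrm{ref}})$, and the applied control value is $u_{p,k}=u_k^\star(0)=P_U(\tfrac1\alpha B^*\lambda_{0,k}+u_{\mathrm{ref}})$. -/

import Mathlib

open MeasureTheory Set
open scoped ContDiff

noncomputable section

/-! ### Function spaces on the horizon `(0, tf)` -/

/-- Euclidean space `ℝ^d`. -/
abbrev E (d : ℕ) : Type := EuclideanSpace ℝ (Fin d)

/-- Lebesgue measure on `(0, tf)`. -/
abbrev horizon (tf : ℝ) : Measure ℝ := volume.restrict (Ioo 0 tf)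

/-- `L²(0, tf; ℝ^d)`. -/
abbrev L2 (tf : ℝ) (d : ℕ) : Type := Lp (E d) 2 (horizon tf)

/-- `y` is the weak derivative of `x` on `(0, tf)`; thus `x ∈ H¹(0, tf; ℝ^d)` iff
`∃ y : L2 tf d, IsWeakDeriv tf x y`. -/
def IsWeakDeriv (tf : ℝ) {d : ℕ} (x y : L2 tf d) : Prop :=
  ∀ ψ : ℝ → ℝ, ContDiff ℝ ∞ ψ → HasCompactSupport ψ → tsupport ψ ⊆ Ioo 0 tf →
    ∫ t, deriv ψ t • x t ∂(horizon tf) = - ∫ t, ψ t • y t ∂(horizon tf)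

/-- The class `x` has a representative that is continuous on `[0, tf]`, and the value of this
representative at `t₀` is `a`. For `t₀ ∈ [0, tf]` and `0 < tf`, `a` is determined by `x`. -/
def HasPointValue (tf : ℝ) {d : ℕ} (x : L2 tf d) (t₀ : ℝ) (a : E d) : Prop :=
  ∃ c : ℝ → E d, ContinuousOn c (Icc 0 tf) ∧ x =ᵐ[horizon tf] c ∧ c t₀ = a

/-- The controls with values in `U` almost everywhere. -/
def controlSet (tf : ℝ) {d : ℕ} (U : Set (E d)) : Set (L2 tf d) :=
  {u | ∀ᵐ t ∂(horizon tf), u t ∈ U}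

open Classical in
/-- The metric projection `P_K` onto a set `K` (for a nonempty closed convex subset `K` of a Hilbert
space the nearest point exists and is unique). -/
def proj {X : Type*} [NormedAddCommGroup X] (K : Set X) (x : X) : X :=
  if hx : ∃ p ∈ K, ∀ q ∈ K, ‖x - p‖ ≤ ‖x - q‖ then hx.choose else x

/-! ### Monotone operators, strong solutions, flows -/

/-- Monotonicity of a set-valued operator, given by its graph. -/
def IsMonotoneOp {X : Type*} [NormedAddCommGroup X] [InnerProductSpace ℝ X]
    (M : Set (X × X)) : Prop :=
  ∀ p ∈ M, ∀ q ∈ M, 0 ≤ inner ℝ (p.2 - q.2) (p.1 - q.1)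

/-- Maximal monotonicity: monotone without a proper monotone extension. -/
def IsMaximallyMonotone {X : Type*} [NormedAddCommGroup X] [InnerProductSpace ℝ X]
    (M : Set (X × X)) : Prop :=
  IsMonotoneOp M ∧ ∀ N : Set (X × X), IsMonotoneOp N → M ⊆ N → N = M

/-- The graph of a single-valued, everywhere defined operator. -/
def opGraph {X : Type*} (M : X → X) : Set (X × X) := {p | p.2 = M p.1}

/-- `x` is a strong solution of `ẋ(t) = G t (x t)`, `x 0 = x₀`, on `[0, T]`. -/
def IsStrongSolutionOn {X : Type*} [NormedAddCommGroup X] [NormedSpace ℝ X]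
    (G : ℝ → X → X) (T : ℝ) (x₀ : X) (x : ℝ → X) : Prop :=
  x 0 = x₀ ∧ (∃ K, LipschitzOnWith K x (Icc 0 T)) ∧
    ∀ᵐ t ∂(volume.restrict (Ioo 0 T)), HasDerivAt x (G t (x t)) t

/-- `φ` is a flow of `v̇ = G v`: for each `v₀`, `t ↦ φ t v₀` is a strong solution on `[0, ∞)`
starting in `v₀`. -/
def IsFlow {X : Type*} [NormedAddCommGroup X] [NormedSpace ℝ X]
    (G : X → X) (φ : ℝ → X → X) : Prop :=
  ∀ v₀ : X, ∀ T > 0, IsStrongSolutionOn (fun _ => G) T v₀ (fun t => φ t v₀)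

/-! ### The optimal control problem and the MPC algorithm -/

section MPC

variable {n m : ℕ}

/-- The quadratic tracking cost. -/
def cost (tf α : ℝ) (xref : E n) (uref : E m) (x : L2 tf n) (u : L2 tf m) : ℝ :=
  ∫ t, ((1 / 2) * ‖x t - xref‖ ^ 2 + (α / 2) * ‖u t - uref‖ ^ 2) ∂(horizon tf)

/-- `(x, u)` is feasible: `ẋ = f (x) + g (u)` weakly, `x(0) = x₀`, and `u ∈ F`. -/
def IsFeasible (tf : ℝ) (f : E n → E n) (g : E m → E n) (F : Set (L2 tf m)) (x₀ : E n)
    (x : L2 tf n) (u : L2 tf m) : Prop :=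
  (∃ y : L2 tf n, IsWeakDeriv tf x y ∧ y =ᵐ[horizon tf] fun t => f (x t) + g (u t)) ∧
    HasPointValue tf x 0 x₀ ∧ u ∈ F

/-- `(x, u)` solves the optimal control problem with initial value `x₀`. -/
def IsOptimal (tf α : ℝ) (xref : E n) (uref : E m) (f : E n → E n) (g : E m → E n)
    (F : Set (L2 tf m)) (x₀ : E n) (x : L2 tf n) (u : L2 tf m) : Prop :=
  IsFeasible tf f g F x₀ x u ∧
    ∀ x' u', IsFeasible tf f g F x₀ x' u' →
      cost tf α xref uref x u ≤ cost tf α xref uref x' u'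

/-- The sequences `xp` (plant states), `xs`, `us` (optimal states and controls) and `up` (applied
control values) are produced by the MPC algorithm for the plant `ẋ = f (x) + g (u)` with prediction
model `ẋ = f' (x) + g' (u)` and sampling time `h`. -/
structure IsMPCRun (tf α h : ℝ) (xref : E n) (uref : E m) (f : E n → E n) (g : E m → E n)
    (f' : E n → E n) (g' : E m → E n) (F : Set (L2 tf m))
    (xp : ℕ → E n) (xs : ℕ → L2 tf n) (us : ℕ → L2 tf m) (up : ℕ → E m) : Prop where
  /-- The optimal control problem is solved for the current plant state. -/
  optimal : ∀ i, IsOptimal tf α xref uref f' g' F (xp i) (xs i) (us i)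
  /-- The initial value of the optimal control is kept as input. -/
  input : ∀ i, HasPointValue tf (us i) 0 (up i)
  /-- The plant evolves with this constant input over one sampling interval. -/
  step : ∀ i, ∃ x : ℝ → E n,
    IsStrongSolutionOn (fun _ ξ => f ξ + g (up i)) h (xp i) x ∧ xp (i + 1) = x h

end MPC

/-! ### The optimality operator and the coupled optimizer-plant system -/

/-- The optimizer state space `W = L² × L² × ℝ^n`, with elements `(x, (lam, lam₀))`. Only its
vector space structure and topology are used, so the product norm may be taken. -/
abbrev W (tf : ℝ) (n : ℕ) : Type := L2 tf n × L2 tf n × E n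

/-- The coupled state space `V = ℝ^n × W`, with elements `(x_p, w)`. -/
abbrev V (tf : ℝ) (n : ℕ) : Type := E n × W tf n

section Coupled

variable {n m : ℕ}

/-- The control value `P_U (α⁻¹ B* q + uref) ∈ ℝ^m` for `q ∈ ℝ^n`. -/
def feedback (α : ℝ) (B : E m →L[ℝ] E n) (uref : E m) (U : Set (E m)) (q : E n) : E m :=
  proj U ((1 / α) • ContinuousLinearMap.adjoint B q + uref)

/-- The control `P_F (α⁻¹ B* lam + uref)` in `L²`. -/
def reducedControl (tf α : ℝ) (B : E m →L[ℝ] E n) (uref : E m) (F : Set (L2 tf m))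
    (lam : L2 tf n) : L2 tf m :=
  proj F ((1 / α) • (ContinuousLinearMap.adjoint B).compLp lam + Lp.const 2 (horizon tf) uref)

/-- The embedding `x₀ ↦ (0, (0, x₀))` of `ℝ^n` into `W`. -/
def embed (tf : ℝ) (x₀ : E n) : W tf n := (0, 0, x₀)

/-- The graph of the operator `M_{opt,x₀}` of the control-reduced optimality system,
`(x, (lam, lam₀)) ↦ (x - xref - lam' - A* lam, (-(x' - A x) + B P_F(α⁻¹ B* lam + uref), -x(0) + x₀))`,
with domain `x, lam ∈ H¹`, `lam(0) = lam₀`, `lam(tf) = 0`. -/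
def Mopt (tf α : ℝ) (xref : E n) (uref : E m) (A : E n →L[ℝ] E n) (B : E m →L[ℝ] E n)
    (F : Set (L2 tf m)) (x₀ : E n) : Set (W tf n × W tf n) :=
  {p | match p with
    | ((x, lam, lam₀), (a, b, c)) =>
      ∃ (x' lam' : L2 tf n) (ξ : E n),
        IsWeakDeriv tf x x' ∧ HasPointValue tf x 0 ξ ∧
        IsWeakDeriv tf lam lam' ∧ HasPointValue tf lam 0 lam₀ ∧ HasPointValue tf lam tf 0 ∧
        a = x - Lp.const 2 (horizon tf) xref
          + (-lam' - (ContinuousLinearMap.adjoint A).compLp lam) ∧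
        b = -(x' - A.compLp x) + B.compLp (reducedControl tf α B uref F lam) ∧
        c = -ξ + x₀}

/-- The inverse of `M_{opt,0}` (a chosen preimage, arbitrary outside the range). -/
def MoptInv (tf α : ℝ) (xref : E n) (uref : E m) (A : E n →L[ℝ] E n) (B : E m →L[ℝ] E n)
    (F : Set (L2 tf m)) (y : W tf n) : W tf n :=
  Classical.epsilon fun w => (w, y) ∈ Mopt tf α xref uref A B F 0

/-- The map `r (x_p, w) = (x_p, M_{opt,0}⁻¹ (-(0, (0, x_p))))` resolving the algebraic constraint. -/
def resolve (tf α : ℝ) (xref : E n) (uref : E m) (A : E n →L[ℝ] E n) (B : E m →L[ℝ] E n)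
    (F : Set (L2 tf m)) (v : V tf n) : V tf n :=
  (v.1, MoptInv tf α xref uref A B F (-embed tf v.1))

/-- The plant part `F₁ (x_p, w) = (-M_p (x_p) + B_p P_U (α⁻¹ B* lam₀ + uref), 0)`. -/
def F1 (tf α : ℝ) (uref : E m) (Mp : E n → E n) (Bp B : E m →L[ℝ] E n) (U : Set (E m))
    (v : V tf n) : V tf n :=
  (-Mp v.1 + Bp (feedback α B uref U v.2.2.2), 0)

/-- The graph of the set-valued operator `M₀` of the differential-algebraic coupled system
`v̇ + M₀ (v) ∋ 0`: the second component of the value is free, and the algebraic constraint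
`0 = M_{opt,0} (w) + (0, (0, x_p))` is imposed on `v = (x_p, w)`. -/
def M0 (tf α : ℝ) (xref : E n) (uref : E m) (Mp : E n → E n) (Bp : E m →L[ℝ] E n)
    (A : E n →L[ℝ] E n) (B : E m →L[ℝ] E n) (U : Set (E m)) : Set (V tf n × V tf n) :=
  {p | p.2.1 = Mp p.1.1 - Bp (feedback α B uref U p.1.2.2.2) ∧
    ∃ y, (p.1.2, y) ∈ Mopt tf α xref uref A B (controlSet tf U) 0 ∧ 0 = y + embed tf p.1.1}

/-- The domain of a set-valued operator. -/
def opDom {X : Type*} (M : Set (X × X)) : Set X := {v | ∃ y, (v, y) ∈ M}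

end Coupled

end

/-!
For fixed input the plant `ẋ = -M x + c` has a dissipative right-hand side. A maximally monotone map
defined on all of `ℝⁿ` is continuous (`IsMaximallyMonotone.continuous_of_opGraph`). Trajectories of
Lipschitz approximations of a continuous dissipative field form a Cauchy sequence because the
squared distance of two of them grows only with the approximation errors; their limit is a strong
solution (`exists_isStrongSolutionOn_of_dissipative`). The same estimate gives uniqueness. The
optimizer state is constant along the flow of the plant part (`isStrongSolutionOn_F1_iff`), so this
flow is the plant step of the MPC algorithm with the input frozen at its initial value.

Classes in `L²` with a weak derivative are, by the du Bois-Reymond lemma, the antiderivatives of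
their weak derivatives. This gives point values, integration by parts
(`IsWeakDeriv.inner_add_inner`), and, with variation of constants, the solvability of linear
equations with square integrable forcing. Integration by parts puts a linear control system and the
adjoint equation in duality (`IsTrajectory.inner_eq`), and this duality carries the rest:

* the trajectories with given initial value form a closed affine set, so that the optimal control
  problem is the projection of a point of a Hilbert space onto a closed convex set; the variational
  inequality of this projection, rewritten with the adjoint state, says that the control is
  `P_F (α⁻¹ B* λ + uref)`, which solves the optimality system (`exists_isOptimalitySolution`);
* conversely the cost grows quadratically away from any solution of the optimality system
  (`IsOptimalitySolution.cost_add_le`), so that such a solution is the unique minimizer, and the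
  costate is then determined by its linear equation.

The projection onto the controls with values in `U` is pointwise (`proj_controlSet_ae_eq`), so the
optimal control inherits a continuous representative from the costate, with initial value
`P_U (α⁻¹ B* λ(0) + uref)`. Thus a consistent state `(x_p, w)` of the splitting scheme encodes
exactly one step of the MPC algorithm, and induction identifies the two sequences.
-/

open Filter Topology

/-! ### Absolutely continuous functions -/

namespace AbsolutelyContinuousOnInterval

/-- A function that varies no more than an absolutely continuous one is absolutely continuous. -/
theorem of_dist_le {X Y : Type*} [PseudoMetricSpace X] [PseudoMetricSpace Y] {f : ℝ → X}
    {g : ℝ → Y} {a b : ℝ} (hg : AbsolutelyContinuousOnInterval g a b)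
    (h : ∀ s ∈ uIcc a b, ∀ t ∈ uIcc a b, dist (f s) (f t) ≤ dist (g s) (g t)) :
    AbsolutelyContinuousOnInterval f a b := by
  rw [absolutelyContinuousOnInterval_iff] at hg ⊢
  intro ε hε
  obtain ⟨δ, hδ, H⟩ := hg ε hε
  refine ⟨δ, hδ, fun I hI hlt ↦ (Finset.sum_le_sum fun i hi ↦ ?_).trans_lt (H I hI hlt)⟩
  exact h _ (hI.1 i hi).1 _ (hI.1 i hi).2

theorem inner {F : Type*} [NormedAddCommGroup F] [InnerProductSpace ℝ F] {f g : ℝ → F} {a b : ℝ}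
    (hf : AbsolutelyContinuousOnInterval f a b) (hg : AbsolutelyContinuousOnInterval g a b) :
    AbsolutelyContinuousOnInterval (fun t ↦ inner ℝ (f t) (g t)) a b := by
  have hn : ∀ {k : ℝ → F}, AbsolutelyContinuousOnInterval k a b →
      AbsolutelyContinuousOnInterval (fun t ↦ ‖k t‖ * ‖k t‖) a b := fun hk ↦
    have := hk.of_dist_le (f := fun t ↦ ‖_‖) fun s _ t _ ↦ by
      simpa only [dist_eq_norm] using dist_norm_norm_le _ _
    this.mul this
  -- polarization reduces the claim to squared norms
  convert ((hn (hf.add hg)).sub (hn (hf.sub hg))).const_mul (1 / 4) using 2 with t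
  simp only [Pi.sub_apply, Pi.add_apply]
  rw [norm_add_mul_self_real, norm_sub_mul_self_real]
  ring

end AbsolutelyContinuousOnInterval

theorem IntervalIntegrable.absolutelyContinuousOnInterval_integral {F : Type*}
    [NormedAddCommGroup F] [NormedSpace ℝ F] {f : ℝ → F} {a b : ℝ}
    (hf : IntervalIntegrable f volume a b) :
    AbsolutelyContinuousOnInterval (fun t ↦ ∫ s in a..t, f s) a b := by
  have hsub : ∀ {s t}, s ∈ uIcc a b → t ∈ uIcc a b → uIcc s t ⊆ uIcc a b :=
    fun hs ht ↦ uIcc_subset_uIcc hs ht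
  refine (hf.norm.absolutelyContinuousOnInterval_intervalIntegral (c := a)
    left_mem_uIcc).of_dist_le fun s hs t ht ↦ ?_
  have ha := left_mem_uIcc (a := a) (b := b)
  rw [dist_comm, dist_eq_norm, dist_comm, Real.dist_eq,
    intervalIntegral.integral_interval_sub_left (hf.mono_set (hsub ha ht))
      (hf.mono_set (hsub ha hs)),
    intervalIntegral.integral_interval_sub_left (hf.norm.mono_set (hsub ha ht))
      (hf.norm.mono_set (hsub ha hs))]
  exact intervalIntegral.norm_integral_le_abs_integral_norm

/-- The fundamental theorem of calculus with values in a Banach space. The existence of the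
derivative almost everywhere is a hypothesis, since it may fail in infinite dimensions. -/
theorem AbsolutelyContinuousOnInterval.eq_add_integral {F : Type*} [NormedAddCommGroup F]
    [NormedSpace ℝ F] [CompleteSpace F] {f f' : ℝ → F} {a b : ℝ}
    (hf : AbsolutelyContinuousOnInterval f a b)
    (hf' : IntervalIntegrable f' volume a b)
    (hd : ∀ᵐ t, t ∈ uIcc a b → HasDerivAt f (f' t) t) :
    ∀ t ∈ uIcc a b, f t = f a + ∫ s in a..t, f' s := by
  obtain ⟨C, hC⟩ := (hf.sub
    hf'.absolutelyContinuousOnInterval_integral).const_of_ae_hasDerivAt_zero (by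
    filter_upwards [hd, hf'.ae_hasDerivAt_integral] with t h₁ h₂ ht
    simpa using (h₁ ht).sub (h₂ ht a left_mem_uIcc))
  intro t ht
  have h₁ := hC t ht
  have h₂ := hC a left_mem_uIcc
  simp only [Pi.sub_apply, intervalIntegral.integral_same, sub_zero] at h₁ h₂
  rw [h₂, ← h₁]; abel

theorem ae_mem_uIcc_of_ae_restrict_Ioo {p : ℝ → Prop} {a b : ℝ} (hab : a ≤ b)
    (h : ∀ᵐ t ∂(volume.restrict (Ioo a b)), p t) : ∀ᵐ t, t ∈ uIcc a b → p t := by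
  rw [uIcc_of_le hab]
  rw [restrict_Ioo_eq_restrict_Icc] at h
  exact (ae_restrict_iff' measurableSet_Icc).1 h

/-! ### Evolution equations with a dissipative vector field -/

section Dissipative

variable {X : Type*} [NormedAddCommGroup X] [InnerProductSpace ℝ X]

/-- The basic estimate: a one-sided bound on the difference of the velocities bounds the growth of
the squared distance. -/
theorem norm_sub_sq_le_of_ae_hasDerivAt {T C : ℝ} {x y x' y' : ℝ → X}
    (hx : AbsolutelyContinuousOnInterval x 0 T) (hy : AbsolutelyContinuousOnInterval y 0 T)
    (hx' : ∀ᵐ t ∂(volume.restrict (Ioo 0 T)), HasDerivAt x (x' t) t)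
    (hy' : ∀ᵐ t ∂(volume.restrict (Ioo 0 T)), HasDerivAt y (y' t) t)
    (hC : ∀ t ∈ Ioo 0 T, inner ℝ (x' t - y' t) (x t - y t) ≤ C) {t : ℝ} (ht : t ∈ Icc 0 T) :
    ‖x t - y t‖ ^ 2 ≤ ‖x 0 - y 0‖ ^ 2 + 2 * C * t := by
  have hT : 0 ≤ T := ht.1.trans ht.2
  have hsub : uIcc 0 t ⊆ uIcc 0 T := uIcc_subset_uIcc left_mem_uIcc (by rwa [uIcc_of_le hT])
  have hac := ((hx.sub hy).inner (hx.sub hy)).mono hsub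
  have h₁ := hac.integral_deriv_eq_sub
  have h₂ : ∫ s in 0..t, deriv (fun t ↦ inner ℝ ((x - y) t) ((x - y) t)) s ≤
      ∫ s in 0..t, 2 * C := by
    refine intervalIntegral.integral_mono_ae_restrict ht.1 hac.intervalIntegrable_deriv
      intervalIntegrable_const ?_
    rw [← restrict_Ioo_eq_restrict_Icc]
    have hle : volume.restrict (Ioo 0 t) ≤ volume.restrict (Ioo 0 T) :=
      Measure.restrict_mono (Ioo_subset_Ioo_right ht.2) le_rfl
    filter_upwards [ae_mono hle hx', ae_mono hle hy', ae_restrict_mem measurableSet_Ioo]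
      with s hxs hys hs
    have hd := (hxs.sub hys).inner ℝ (hxs.sub hys)
    have := hC s ⟨hs.1, hs.2.trans_le ht.2⟩
    rw [hd.deriv, real_inner_comm]
    simp only [Pi.sub_apply]
    linarith
  rw [h₁] at h₂
  simp only [intervalIntegral.integral_const, smul_eq_mul, sub_zero, Pi.sub_apply,
    real_inner_self_eq_norm_sq] at h₂
  linarith

variable {G : X → X} {T T' : ℝ} {x₀ : X} {x y : ℝ → X}

theorem IsStrongSolutionOn.mono {Y : Type*} [NormedAddCommGroup Y] [NormedSpace ℝ Y]
    {G : ℝ → Y → Y} {x₀ : Y} {x : ℝ → Y}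
    (hx : IsStrongSolutionOn G T x₀ x) (h : T' ≤ T) : IsStrongSolutionOn G T' x₀ x :=
  ⟨hx.1, hx.2.1.imp fun _ hK ↦ hK.mono (Icc_subset_Icc_right h),
    ae_mono (Measure.restrict_mono (Ioo_subset_Ioo_right h) le_rfl) hx.2.2⟩

theorem IsStrongSolutionOn.absolutelyContinuousOnInterval {Y : Type*} [NormedAddCommGroup Y]
    [NormedSpace ℝ Y] {G : ℝ → Y → Y} {x₀ : Y} {x : ℝ → Y}
    (hx : IsStrongSolutionOn G T x₀ x) (hT : 0 ≤ T) : AbsolutelyContinuousOnInterval x 0 T := by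
  obtain ⟨K, hK⟩ := hx.2.1
  exact LipschitzOnWith.absolutelyContinuousOnInterval (K := K) (by rwa [uIcc_of_le hT])

theorem IsStrongSolutionOn.eqOn_of_dissipative
    (hG : ∀ x y, inner ℝ (G x - G y) (x - y) ≤ 0)
    (hx : IsStrongSolutionOn (fun _ ↦ G) T x₀ x) (hy : IsStrongSolutionOn (fun _ ↦ G) T x₀ y) :
    EqOn x y (Icc 0 T) := by
  intro t ht
  have hT := ht.1.trans ht.2
  have := norm_sub_sq_le_of_ae_hasDerivAt (hx.absolutelyContinuousOnInterval hT)
    (hy.absolutelyContinuousOnInterval hT) hx.2.2 hy.2.2 (fun s _ ↦ hG (x s) (y s)) ht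
  rw [hx.1, hy.1] at this
  have : ‖x t - y t‖ ^ 2 ≤ 0 := by simpa using this
  exact sub_eq_zero.1 (norm_eq_zero.1 (by nlinarith [norm_nonneg (x t - y t)]))

/-- Solutions of dissipative equations on bounded intervals agree where both are defined, so they
glue to a flow on `[0, ∞)`. -/
theorem exists_isFlow_of_dissipative
    (hG : ∀ x y, inner ℝ (G x - G y) (x - y) ≤ 0)
    (hex : ∀ T > 0, ∀ x₀, ∃ x, IsStrongSolutionOn (fun _ ↦ G) T x₀ x) : ∃ φ, IsFlow G φ := by
  choose! S hS using hex
  have hpos : ∀ N : ℕ, (0 : ℝ) < N + 1 := fun N ↦ by positivity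
  refine ⟨fun t x₀ ↦ S (⌊t⌋₊ + 1) x₀ t, fun x₀ T hT ↦ ?_⟩
  have hsol : IsStrongSolutionOn (fun _ ↦ G) T x₀ (S (⌊T⌋₊ + 1) x₀) :=
    (hS _ (hpos _) x₀).mono (Nat.lt_floor_add_one T).le
  have heq : EqOn (fun t ↦ S (⌊t⌋₊ + 1) x₀ t) (S (⌊T⌋₊ + 1) x₀) (Icc 0 T) := fun t ht ↦ by
    have hle : (⌊t⌋₊ : ℝ) + 1 ≤ ⌊T⌋₊ + 1 := by
      gcongr; exact ht.2
    exact (hS _ (hpos _) x₀).eqOn_of_dissipative hG ((hS _ (hpos _) x₀).mono hle)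
      ⟨ht.1, (Nat.lt_floor_add_one t).le⟩
  refine ⟨(hS _ (hpos _) x₀).1, ?_, ?_⟩
  · obtain ⟨K, hK⟩ := hsol.2.1
    exact ⟨K, fun s hs t ht ↦ by simpa only [heq hs, heq ht] using hK hs ht⟩
  · filter_upwards [hsol.2.2, ae_restrict_mem measurableSet_Ioo] with t h ht
    have hev : (fun t ↦ S (⌊t⌋₊ + 1) x₀ t) =ᶠ[𝓝 t] S (⌊T⌋₊ + 1) x₀ :=
      (heq.mono Ioo_subset_Icc_self).eventuallyEq_of_mem (Ioo_mem_nhds ht.1 ht.2)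
    simpa only [hev.eq_of_nhds] using h.congr_of_eventuallyEq hev

end Dissipative

/-! ### Continuity of maximally monotone maps -/

section MaximallyMonotone

variable {X : Type*} [NormedAddCommGroup X] [InnerProductSpace ℝ X] [FiniteDimensional ℝ X]
  {f : X → X}

/-- A monotone map on a finite-dimensional space is locally bounded: near `x₀`, monotonicity
against the points `x₀ ± eᵢ` for an orthonormal basis `e` bounds all coordinates of the value. -/
theorem exists_eventually_norm_le_of_monotone (hf : ∀ x y, 0 ≤ inner ℝ (f x - f y) (x - y))
    (x₀ : X) : ∃ C, ∀ᶠ x in 𝓝 x₀, ‖f x‖ ≤ C := by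
  let e := stdOrthonormalBasis ℝ X
  let d : ℝ := Module.finrank ℝ X
  let C := ∑ i, (‖f (x₀ + e i)‖ + ‖f (x₀ - e i)‖)
  have hd : 0 ≤ d := Nat.cast_nonneg _
  have hδ : 0 < 1 / (2 * d + 1) := by positivity
  -- on this ball the error `‖f x‖ * ‖x - x₀‖`, summed over the `d` coordinates, is at most
  -- `‖f x‖ / 2` and can be absorbed
  refine ⟨4 * d * C, ?_⟩
  filter_upwards [Metric.ball_mem_nhds x₀ hδ] with x hx
  rw [Metric.mem_ball, dist_eq_norm] at hx
  have hx1 : ‖x - x₀‖ ≤ 1 := hx.le.trans (by rw [div_le_one (by positivity)]; linarith)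
  have hdir : ∀ u : X, ‖u‖ = 1 → ‖f (x₀ + u)‖ ≤ C →
      inner ℝ (f x) u ≤ 2 * C + ‖f x‖ * (1 / (2 * d + 1)) := by
    intro u hu hC
    have h₁ := hf (x₀ + u) x
    have h₂ : inner ℝ (f (x₀ + u)) (x₀ + u - x) ≤ C * 2 := by
      refine (real_inner_le_norm _ _).trans ?_
      gcongr
      calc ‖x₀ + u - x‖ = ‖u - (x - x₀)‖ := by congr 1; abel
        _ ≤ ‖u‖ + ‖x - x₀‖ := norm_sub_le _ _
        _ ≤ 2 := by linarith
    have h₃ : inner ℝ (f x) (x - x₀) ≤ ‖f x‖ * (1 / (2 * d + 1)) :=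
      (real_inner_le_norm _ _).trans (by gcongr)
    have h₄ : inner ℝ (f x) u = inner ℝ (f x) (x₀ + u - x) + inner ℝ (f x) (x - x₀) := by
      rw [← inner_add_right]; congr 1; abel
    rw [inner_sub_left] at h₁
    linarith
  have hterm : ∀ i, ‖f (x₀ + e i)‖ + ‖f (x₀ - e i)‖ ≤ C := fun i ↦
    Finset.single_le_sum (f := fun i ↦ ‖f (x₀ + e i)‖ + ‖f (x₀ - e i)‖)
      (fun _ _ ↦ by positivity) (Finset.mem_univ i)
  have hcoord : ∀ i, ‖inner ℝ (e i) (f x)‖ ≤ 2 * C + ‖f x‖ * (1 / (2 * d + 1)) := by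
    intro i
    have hi := hterm i
    have h₁ := hdir (e i) (e.norm_eq_one i) (by linarith [norm_nonneg (f (x₀ - e i))])
    have h₂ := hdir (-e i) (by rw [norm_neg]; exact e.norm_eq_one i)
      (by rw [← sub_eq_add_neg]; linarith [norm_nonneg (f (x₀ + e i))])
    rw [inner_neg_right] at h₂
    rw [real_inner_comm, Real.norm_eq_abs, abs_le]
    constructor <;> linarith
  have hsum : ‖f x‖ ≤ d * (2 * C + ‖f x‖ * (1 / (2 * d + 1))) := by
    calc ‖f x‖ = ‖∑ i, inner ℝ (e i) (f x) • e i‖ := by rw [e.sum_repr']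
      _ ≤ ∑ i, ‖inner ℝ (e i) (f x)‖ := by
        refine (norm_sum_le _ _).trans (Finset.sum_le_sum fun i _ ↦ ?_)
        rw [norm_smul, e.norm_eq_one i, mul_one]
      _ ≤ ∑ i : Fin (Module.finrank ℝ X), (2 * C + ‖f x‖ * (1 / (2 * d + 1))) :=
        Finset.sum_le_sum fun i _ ↦ hcoord i
      _ = _ := by
        rw [Finset.sum_const, nsmul_eq_mul, Finset.card_univ, Fintype.card_fin]
  have hhalf : d * (1 / (2 * d + 1)) ≤ 1 / 2 := by
    rw [mul_one_div, div_le_div_iff₀ (by positivity) (by positivity)]; linarith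
  nlinarith [norm_nonneg (f x), mul_le_mul_of_nonneg_right hhalf (norm_nonneg (f x))]

theorem IsMaximallyMonotone.monotone_opGraph {X : Type*} [NormedAddCommGroup X]
    [InnerProductSpace ℝ X] {f : X → X} (hf : IsMaximallyMonotone (opGraph f)) (x y : X) :
    0 ≤ inner ℝ (f x - f y) (x - y) :=
  hf.1 (x, f x) rfl (y, f y) rfl

/-- An everywhere defined single-valued maximally monotone operator on a finite-dimensional space
is continuous: by local boundedness its values cluster near every point, and by maximality the
only possible cluster value is the value at the point. -/
theorem IsMaximallyMonotone.continuous_of_opGraph (hf : IsMaximallyMonotone (opGraph f)) :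
    Continuous f := by
  rw [continuous_iff_continuousAt]
  intro x₀
  have hmono := hf.monotone_opGraph
  obtain ⟨C, hC⟩ := exists_eventually_norm_le_of_monotone hmono x₀
  refine (isCompact_closedBall (0 : X) C).tendsto_nhds_of_unique_mapClusterPt
    (hC.mono fun x hx ↦ by simpa using hx) fun y _ hy ↦ ?_
  obtain ⟨U, hU, hUy⟩ := mapClusterPt_iff_ultrafilter.1 hy
  have hrel : ∀ z, 0 ≤ inner ℝ (f z - y) (z - x₀) := fun z ↦
    ge_of_tendsto' ((tendsto_const_nhds.sub hUy).inner
      (tendsto_const_nhds.sub (tendsto_id.mono_left hU))) fun x ↦ hmono z x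
  -- the graph together with the cluster point is still monotone
  have hins : IsMonotoneOp (insert (x₀, y) (opGraph f)) := by
    rintro ⟨a, a'⟩ (h | h) ⟨b, b'⟩ (h' | h')
    · simp_all
    · cases h
      obtain rfl : b' = f b := h'
      have := hrel b
      rwa [← neg_sub y, ← neg_sub x₀, inner_neg_neg] at this
    · cases h'
      obtain rfl : a' = f a := h
      exact hrel a
    · exact hf.1 _ h _ h'
  have := hf.2 _ hins (subset_insert _ _)
  exact (this ▸ mem_insert (x₀, y) (opGraph f) : (x₀, y) ∈ opGraph f)

end MaximallyMonotone

/-! ### Existence for continuous dissipative vector fields -/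

section Existence

variable {X : Type*} [NormedAddCommGroup X] [InnerProductSpace ℝ X] [FiniteDimensional ℝ X]
  {G : X → X}

/-- A radius containing, up to time `T`, the trajectories starting in `x₀` of all vector fields `v`
with `⟪v z, z⟫ ≤ C₀ * ‖z‖`. -/
noncomputable def trajectoryRadius {X : Type*} [NormedAddCommGroup X] (C₀ T : ℝ) (x₀ : X) : ℝ :=
  √(1 + ‖x₀‖ ^ 2) + C₀ * T

theorem norm_le_trajectoryRadius {X : Type*} [NormedAddCommGroup X] [InnerProductSpace ℝ X]
    {C₀ T : ℝ} {x₀ : X} {v : X → X} {x : ℝ → X} (hC₀ : 0 ≤ C₀)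
    (hv : ∀ z, inner ℝ (v z) z ≤ C₀ * ‖z‖) (hx₀ : x 0 = x₀) (hxc : ContinuousOn x (Icc 0 T))
    (hx : ∀ t ∈ Ioo 0 T, HasDerivAt x (v (x t)) t) {t : ℝ} (ht : t ∈ Icc 0 T) :
    ‖x t‖ ≤ trajectoryRadius C₀ T x₀ := by
  -- `√(1 + ‖x‖²)` is a smooth substitute for `‖x‖`
  have hT := ht.1.trans ht.2
  have hd : ∀ t ∈ Ioo 0 T, HasDerivAt (fun t ↦ √(1 + ‖x t‖ ^ 2))
      (2 * inner ℝ (x t) (v (x t)) / (2 * √(1 + ‖x t‖ ^ 2))) t := fun t ht ↦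
    (((hx t ht).norm_sq).const_add 1).sqrt (by positivity)
  have hgrow := (convex_Icc 0 T).image_sub_le_mul_sub_of_deriv_le (C := C₀)
    (f := fun t ↦ √(1 + ‖x t‖ ^ 2))
    (by fun_prop) (by
      rw [interior_Icc]
      exact fun t ht ↦ (hd t ht).differentiableAt.differentiableWithinAt) (by
      rw [interior_Icc]
      intro t ht
      rw [(hd t ht).deriv, mul_div_mul_left _ _ two_ne_zero, div_le_iff₀ (by positivity),
        real_inner_comm]
      refine (hv (x t)).trans (mul_le_mul_of_nonneg_left ?_ hC₀)
      exact Real.le_sqrt_of_sq_le (by linarith)) 0 (left_mem_Icc.2 hT) t ht ht.1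
  have hle : ‖x t‖ ≤ √(1 + ‖x t‖ ^ 2) := Real.le_sqrt_of_sq_le (by linarith)
  have hmul : C₀ * (t - 0) ≤ C₀ * T := mul_le_mul_of_nonneg_left (by linarith [ht.2]) hC₀
  simp only [hx₀] at hgrow
  unfold trajectoryRadius
  linarith

/-- Approximate trajectories: cutting off a smooth uniform approximation of `G` outside a large
ball yields a Lipschitz vector field, and dissipativity keeps its trajectories inside the ball. -/
theorem exists_approximate_trajectory (hGc : Continuous G)
    (hG : ∀ x y, inner ℝ (G x - G y) (x - y) ≤ 0) {T : ℝ} (hT : 0 < T) (x₀ : X) {ε : ℝ}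
    (hε : 0 < ε) (hε1 : ε ≤ 1) :
    ∃ (v : X → X) (x : ℝ → X), Continuous v ∧ x 0 = x₀ ∧
      (∀ t ∈ Icc 0 T, HasDerivWithinAt x (v (x t)) (Icc 0 T) t) ∧
      (∀ t ∈ Icc 0 T, ‖x t‖ ≤ trajectoryRadius (‖G 0‖ + 1) T x₀) ∧
      ∀ z, ‖z‖ ≤ trajectoryRadius (‖G 0‖ + 1) T x₀ → ‖v z - G z‖ ≤ ε := by
  set R := trajectoryRadius (‖G 0‖ + 1) T x₀ with hR
  have hRpos : 0 < R := by rw [hR, trajectoryRadius]; positivity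
  obtain ⟨g, hg, hgG, -⟩ := hGc.exists_contDiff_approx 1 (continuous_const (y := ε)) fun _ ↦ hε
  let χ : ContDiffBump (0 : X) := ⟨R, R + 1, hRpos, by linarith⟩
  let v : X → X := fun z ↦ χ z • g z
  have hvd : ContDiff ℝ 1 v := χ.contDiff.smul hg
  have hvs : HasCompactSupport v := χ.hasCompactSupport.smul_right
  obtain ⟨K, hK⟩ := hvd.lipschitzWith_of_hasCompactSupport hvs one_ne_zero
  obtain ⟨L, hL⟩ := hvs.exists_bound_of_continuous hvd.continuous
  have hgG' : ∀ z, ‖g z - G z‖ ≤ ε := fun z ↦ by simpa [dist_eq_norm] using (hgG z).le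
  have hvin : ∀ z, inner ℝ (v z) z ≤ (‖G 0‖ + 1) * ‖z‖ := by
    intro z
    have h₁ := hG z 0
    have h₂ : inner ℝ (g z - G z) z ≤ 1 * ‖z‖ :=
      (real_inner_le_norm _ _).trans (by gcongr; exact (hgG' z).trans hε1)
    have h₃ : inner ℝ (G 0) z ≤ ‖G 0‖ * ‖z‖ := real_inner_le_norm _ _
    rw [sub_zero, inner_sub_left] at h₁
    rw [inner_sub_left] at h₂
    have h₄ : inner ℝ (g z) z ≤ (‖G 0‖ + 1) * ‖z‖ := by linarith
    calc inner ℝ (v z) z = χ z * inner ℝ (g z) z := real_inner_smul_left _ _ _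
      _ ≤ χ z * ((‖G 0‖ + 1) * ‖z‖) := mul_le_mul_of_nonneg_left h₄ χ.nonneg
      _ ≤ 1 * ((‖G 0‖ + 1) * ‖z‖) := by gcongr; exact χ.le_one
      _ = _ := one_mul _
  have hL0 : 0 ≤ L := (norm_nonneg _).trans (hL 0)
  -- `v` is globally bounded by `L`, so a ball of radius `L * T` makes `[0, T]` admissible
  have hPL : IsPicardLindelof (fun _ ↦ v) (tmin := 0) (tmax := T) ⟨0, left_mem_Icc.2 hT.le⟩ x₀
      (L * T).toNNReal 0 L.toNNReal K :=
    IsPicardLindelof.of_time_independent (fun z _ ↦ (hL z).trans (Real.le_coe_toNNReal L))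
      hK.lipschitzOnWith (by
        simp [Real.coe_toNNReal _ hL0, Real.coe_toNNReal _ (mul_nonneg hL0 hT.le), hT.le])
  obtain ⟨x, hx₀, hx⟩ := hPL.exists_eq_forall_mem_Icc_hasDerivWithinAt₀
  have hxc : ContinuousOn x (Icc 0 T) := HasDerivWithinAt.continuousOn hx
  have hxd : ∀ t ∈ Ioo 0 T, HasDerivAt x (v (x t)) t := fun t ht ↦
    (hx t (Ioo_subset_Icc_self ht)).hasDerivAt (Icc_mem_nhds ht.1 ht.2)
  refine ⟨v, x, hvd.continuous, hx₀, hx, fun t ht ↦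
    norm_le_trajectoryRadius (by positivity) hvin hx₀ hxc hxd ht, fun z hz ↦ ?_⟩
  have : χ z = 1 := χ.one_of_mem_closedBall (by simpa using hz)
  simpa [v, this] using hgG' z

/-- Existence for continuous dissipative vector fields. By dissipativity, two approximate
trajectories have a distance controlled by the errors of their vector fields, so the approximate
trajectories converge; the limit solves the integral equation. -/
theorem exists_isStrongSolutionOn_of_dissipative (hGc : Continuous G)
    (hG : ∀ x y, inner ℝ (G x - G y) (x - y) ≤ 0) {T : ℝ} (hT : 0 < T) (x₀ : X) :
    ∃ x, IsStrongSolutionOn (fun _ ↦ G) T x₀ x := by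
  set R := trajectoryRadius (‖G 0‖ + 1) T x₀ with hR
  have hRpos : 0 < R := by rw [hR, trajectoryRadius]; positivity
  let ε : ℕ → ℝ := fun k ↦ 1 / ((k : ℝ) + 1)
  have hε : ∀ k, 0 < ε k := fun k ↦ by positivity
  have hε1 : ∀ k, ε k ≤ 1 := fun k ↦ by
    rw [div_le_one (by positivity)]; linarith [(Nat.cast_nonneg k : (0 : ℝ) ≤ k)]
  have hεlim : Tendsto ε atTop (𝓝 0) := tendsto_one_div_add_atTop_nhds_zero_nat
  choose v x hvc hx₀ hxw hxR hvG using fun k ↦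
    exists_approximate_trajectory hGc hG hT x₀ (hε k) (hε1 k)
  have hxc : ∀ k, ContinuousOn (x k) (Icc 0 T) := fun k ↦ HasDerivWithinAt.continuousOn (hxw k)
  obtain ⟨CG, hCG⟩ := (isCompact_closedBall (0 : X) R).exists_bound_of_continuousOn hGc.continuousOn
  have hvbd : ∀ k, ∀ t ∈ Icc 0 T, ‖v k (x k t)‖ ≤ CG + 1 := fun k t ht ↦ by
    have h₁ := hCG (x k t) (by simpa using hxR k t ht)
    have h₂ := (hvG k (x k t) (hxR k t ht)).trans (hε1 k)
    linarith [norm_le_norm_add_norm_sub' (v k (x k t)) (G (x k t))]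
  have hCG0 : 0 ≤ CG + 1 := (norm_nonneg _).trans (hvbd 0 0 (left_mem_Icc.2 hT.le))
  have hlip : ∀ k, LipschitzOnWith (CG + 1).toNNReal (x k) (Icc 0 T) := fun k ↦ by
    refine (convex_Icc 0 T).lipschitzOnWith_of_nnnorm_hasDerivWithin_le (hxw k) fun t ht ↦ ?_
    rw [← NNReal.coe_le_coe, coe_nnnorm, Real.coe_toNNReal _ hCG0]
    exact hvbd k t ht
  have hac : ∀ k, AbsolutelyContinuousOnInterval (x k) 0 T := fun k ↦
    LipschitzOnWith.absolutelyContinuousOnInterval (K := (CG + 1).toNNReal)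
      (by rw [uIcc_of_le hT.le]; exact hlip k)
  have hae : ∀ k, ∀ᵐ t ∂(volume.restrict (Ioo 0 T)), HasDerivAt (x k) (v k (x k t)) t := fun k ↦
    (ae_restrict_mem measurableSet_Ioo).mono fun t ht ↦
      (hxw k t (Ioo_subset_Icc_self ht)).hasDerivAt (Icc_mem_nhds ht.1 ht.2)
  have hcauchy : ∀ t ∈ Icc 0 T, ∀ j k, ‖x j t - x k t‖ ^ 2 ≤ 4 * R * T * (ε j + ε k) := by
    intro t ht j k
    have := norm_sub_sq_le_of_ae_hasDerivAt (C := (ε j + ε k) * (2 * R)) (hac j) (hac k)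
      (hae j) (hae k) (fun s hs ↦ ?_) ht
    · rw [hx₀, hx₀, sub_self, norm_zero] at this
      have h₁ : 0 ≤ (ε j + ε k) * R := by have := hε j; have := hε k; positivity
      nlinarith [ht.2, mul_le_mul_of_nonneg_left ht.2 h₁]
    · have hs' := Ioo_subset_Icc_self hs
      have hj := hvG j (x j s) (hxR j s hs')
      have hk := hvG k (x k s) (hxR k s hs')
      have hsplit : v j (x j s) - v k (x k s) = (G (x j s) - G (x k s)) +
          ((v j (x j s) - G (x j s)) - (v k (x k s) - G (x k s))) := by abel
      rw [hsplit, inner_add_left]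
      have h₁ : inner ℝ ((v j (x j s) - G (x j s)) - (v k (x k s) - G (x k s))) (x j s - x k s) ≤
          (ε j + ε k) * (2 * R) := by
        refine (real_inner_le_norm _ _).trans ?_
        have h₂ : ‖x j s - x k s‖ ≤ 2 * R :=
          (norm_sub_le _ _).trans (by linarith [hxR j s hs', hxR k s hs'])
        exact mul_le_mul ((norm_sub_le _ _).trans (add_le_add hj hk)) h₂ (norm_nonneg _)
          (by have := hε j; have := hε k; positivity)
      linarith [hG (x j s) (x k s)]
  have hlim : ∀ t ∈ Icc 0 T, ∃ y, Tendsto (fun k ↦ x k t) atTop (𝓝 y) := by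
    intro t ht
    refine cauchySeq_tendsto_of_complete (cauchySeq_of_le_tendsto_0
      (fun k ↦ √(4 * R * T * (ε k + ε k))) (fun j k N hj hk ↦ ?_) ?_)
    · rw [dist_eq_norm]
      refine Real.le_sqrt_of_sq_le ((hcauchy t ht j k).trans ?_)
      gcongr <;> exact Nat.one_div_le_one_div ‹_›
    · simpa using ((hεlim.add hεlim).const_mul (4 * R * T)).sqrt
  choose! y hy using hlim
  have hylip : LipschitzOnWith (CG + 1).toNNReal y (Icc 0 T) :=
    LipschitzOnWith.of_dist_le_mul fun s hs t ht ↦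
      le_of_tendsto' ((hy s hs).dist (hy t ht)) fun k ↦ (hlip k).dist_le_mul s hs t ht
  have hGy : ContinuousOn (fun t ↦ G (y t)) (Icc 0 T) := hGc.comp_continuousOn hylip.continuousOn
  have hvlim : ∀ t ∈ Icc 0 T, Tendsto (fun k ↦ v k (x k t)) atTop (𝓝 (G (y t))) := by
    intro t ht
    have h₁ : Tendsto (fun k ↦ v k (x k t) - G (x k t)) atTop (𝓝 0) :=
      squeeze_zero_norm (fun k ↦ hvG k _ (hxR k t ht)) hεlim
    simpa using h₁.add ((hGc.tendsto _).comp (hy t ht))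
  have hint : ∀ t ∈ Icc 0 T, y t = x₀ + ∫ s in 0..t, G (y s) := by
    intro t ht
    have hsub : uIcc 0 t ⊆ Icc 0 T := by
      rw [uIcc_of_le ht.1]; exact Icc_subset_Icc_right ht.2
    have hvx : ∀ k, ContinuousOn (fun s ↦ v k (x k s)) (Icc 0 T) := fun k ↦
      (hvc k).comp_continuousOn (hxc k)
    have h₁ : ∀ k, x k t = x₀ + ∫ s in 0..t, v k (x k s) := fun k ↦ by
      rw [← hx₀ k]
      exact (hac k).eq_add_integral ((hvx k).mono (by rw [uIcc_of_le hT.le])).intervalIntegrable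
        (ae_mem_uIcc_of_ae_restrict_Ioo hT.le (hae k)) t (by rwa [uIcc_of_le hT.le])
    refine tendsto_nhds_unique (hy t ht) ?_
    simp_rw [h₁]
    refine tendsto_const_nhds.add (intervalIntegral.tendsto_integral_filter_of_dominated_convergence
      (fun _ ↦ CG + 1) (Eventually.of_forall fun k ↦ ?_) (Eventually.of_forall fun k ↦ ?_)
      intervalIntegrable_const ?_)
    · exact (((hvx k).mono (uIoc_subset_uIcc.trans hsub)).aestronglyMeasurable measurableSet_uIoc)
    · exact ae_of_all _ fun s hs ↦ hvbd k s (hsub (uIoc_subset_uIcc hs))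
    · exact ae_of_all _ fun s hs ↦ hvlim s (hsub (uIoc_subset_uIcc hs))
  refine ⟨y, by simpa using hint 0 (left_mem_Icc.2 hT.le), ⟨_, hylip⟩, ?_⟩
  filter_upwards [ae_restrict_mem measurableSet_Ioo] with t ht
  have hII : IntervalIntegrable (fun t ↦ G (y t)) volume 0 t :=
    (hGy.mono (by rw [uIcc_of_le ht.1.le]; exact Icc_subset_Icc_right ht.2.le)).intervalIntegrable
  have hnhds : Icc 0 T ∈ 𝓝 t := Icc_mem_nhds ht.1 ht.2
  refine ((intervalIntegral.integral_hasDerivAt_right hII ?_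
    (hGy.continuousAt hnhds)).const_add x₀).congr_of_eventuallyEq
    (Filter.eventually_of_mem hnhds hint)
  exact hGy.stronglyMeasurableAtFilter_nhdsWithin measurableSet_Icc t |>.filter_mono
    (by rw [nhdsWithin_eq_nhds.2 hnhds])

end Existence

/-! ### The flow of the plant part -/

section PlantFlow

variable {n m : ℕ} {tf α : ℝ} {uref : E m} {Mp : E n → E n} {Bp B : E m →L[ℝ] E n} {U : Set (E m)}

theorem IsMaximallyMonotone.dissipative (hMp : IsMaximallyMonotone (opGraph Mp)) (c x y : E n) :
    inner ℝ ((-Mp x + c) - (-Mp y + c)) (x - y) ≤ 0 := by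
  have := hMp.monotone_opGraph x y
  rw [show (-Mp x + c) - (-Mp y + c) = -(Mp x - Mp y) by abel, inner_neg_left]
  linarith

/-- The optimizer state is constant along solutions of the plant part, so that the plant state
evolves with a constant input. -/
theorem isStrongSolutionOn_F1_iff {T : ℝ} (hT : 0 < T) {v₀ : V tf n} {v : ℝ → V tf n} :
    IsStrongSolutionOn (fun _ ↦ F1 tf α uref Mp Bp B U) T v₀ v ↔
      IsStrongSolutionOn (fun _ ξ ↦ -Mp ξ + Bp (feedback α B uref U v₀.2.2.2)) T v₀.1
        (fun t ↦ (v t).1) ∧ ∀ t ∈ Icc 0 T, (v t).2 = v₀.2 := by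
  constructor
  · rintro ⟨h₀, ⟨K, hK⟩, hd⟩
    have hK2 : LipschitzOnWith K (fun t ↦ (v t).2) (uIcc 0 T) := by
      rw [uIcc_of_le hT.le]
      exact fun s hs t ht ↦ (by rw [Prod.edist_eq]; exact le_max_right _ _ :
        edist (v s).2 (v t).2 ≤ edist (v s) (v t)).trans (hK hs ht)
    obtain ⟨w, hw⟩ := hK2.absolutelyContinuousOnInterval.const_of_ae_hasDerivAt_zero
      (ae_mem_uIcc_of_ae_restrict_Ioo hT.le (hd.mono fun t ht ↦
        (ContinuousLinearMap.snd ℝ (E n) (W tf n)).hasFDerivAt.comp_hasDerivAt t ht))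
    rw [uIcc_of_le hT.le] at hw
    have hconst : ∀ t ∈ Icc 0 T, (v t).2 = v₀.2 := fun t ht ↦ by
      rw [hw t ht, ← hw 0 (left_mem_Icc.2 hT.le), h₀]
    refine ⟨⟨congrArg Prod.fst h₀, ⟨K, fun s hs t ht ↦
      (by rw [Prod.edist_eq]; exact le_max_left _ _ :
        edist (v s).1 (v t).1 ≤ edist (v s) (v t)).trans (hK hs ht)⟩, ?_⟩, hconst⟩
    filter_upwards [hd, ae_restrict_mem measurableSet_Ioo] with t ht htm
    have : HasDerivAt (fun t ↦ (v t).1) (F1 tf α uref Mp Bp B U (v t)).1 t :=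
      (ContinuousLinearMap.fst ℝ (E n) (W tf n)).hasFDerivAt.comp_hasDerivAt t ht
    simpa only [F1, hconst t (Ioo_subset_Icc_self htm)] using this
  · rintro ⟨⟨h₀, ⟨K, hK⟩, hd⟩, hconst⟩
    refine ⟨Prod.ext h₀ (hconst 0 (left_mem_Icc.2 hT.le)), ⟨K, fun s hs t ht ↦ ?_⟩, ?_⟩
    · rw [Prod.edist_eq, hconst s hs, hconst t ht, edist_self]
      exact max_le (hK hs ht) (zero_le)
    · filter_upwards [hd, ae_restrict_mem measurableSet_Ioo] with t ht htm
      have hev : (fun s ↦ (v s).2) =ᶠ[𝓝 t] fun _ ↦ v₀.2 :=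
        Filter.eventually_of_mem (Icc_mem_nhds htm.1 htm.2) hconst
      have := ht.prodMk ((hasDerivAt_const t v₀.2).congr_of_eventuallyEq hev)
      simpa only [F1, hconst t (Ioo_subset_Icc_self htm)] using this

theorem exists_isFlow_F1 (hMp : IsMaximallyMonotone (opGraph Mp)) :
    ∃ φ, IsFlow (F1 tf α uref Mp Bp B U) φ := by
  choose ψ hψ using fun c : E n ↦ exists_isFlow_of_dissipative (hMp.dissipative c)
    fun T hT x₀ ↦ exists_isStrongSolutionOn_of_dissipative
      (hMp.continuous_of_opGraph.neg.add continuous_const) (hMp.dissipative c) hT x₀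
  exact ⟨fun t v ↦ (ψ (Bp (feedback α B uref U v.2.2.2)) t v.1, v.2), fun v₀ T hT ↦
    (isStrongSolutionOn_F1_iff hT).2 ⟨hψ _ v₀.1 T hT, fun _ _ ↦ rfl⟩⟩

theorem IsFlow.F1_unique (hMp : IsMaximallyMonotone (opGraph Mp)) {φ φ' : ℝ → V tf n → V tf n}
    (hφ : IsFlow (F1 tf α uref Mp Bp B U) φ) (hφ' : IsFlow (F1 tf α uref Mp Bp B U) φ') {t : ℝ}
    (ht : 0 ≤ t) : φ t = φ' t := by
  funext v₀
  have hT : 0 < t + 1 := by linarith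
  have htm : t ∈ Icc 0 (t + 1) := ⟨ht, by linarith⟩
  have h := (isStrongSolutionOn_F1_iff hT).1 (hφ v₀ _ hT)
  have h' := (isStrongSolutionOn_F1_iff hT).1 (hφ' v₀ _ hT)
  exact Prod.ext (h.1.eqOn_of_dissipative (hMp.dissipative _) h'.1 htm)
    ((h.2 t htm).trans (h'.2 t htm).symm)

end PlantFlow

/-! ### Weak derivatives and point values -/

section WeakDeriv

variable {tf : ℝ} {d : ℕ}

theorem L2.intervalIntegrable (htf : 0 ≤ tf) (f : L2 tf d) : IntervalIntegrable f volume 0 tf :=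
  (intervalIntegrable_iff_integrableOn_Ioo_of_le htf).2 ((Lp.memLp f).integrable one_le_two)

theorem integral_horizon {F : Type*} [NormedAddCommGroup F] [NormedSpace ℝ F] (htf : 0 ≤ tf)
    (f : ℝ → F) : ∫ t, f t ∂(horizon tf) = ∫ t in 0..tf, f t := by
  rw [intervalIntegral.integral_of_le htf, ← integral_Ioc_eq_integral_Ioo]

theorem memLp_horizon_of_continuousOn {F : Type*} [NormedAddCommGroup F] {c : ℝ → F}
    (hc : ContinuousOn c (Icc 0 tf)) : MemLp c 2 (horizon tf) := by
  obtain ⟨C, hC⟩ := isCompact_Icc.exists_bound_of_continuousOn hc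
  exact .of_bound ((hc.mono Ioo_subset_Icc_self).aestronglyMeasurable measurableSet_Ioo) C
    ((ae_restrict_mem measurableSet_Ioo).mono fun t ht ↦ hC t (Ioo_subset_Icc_self ht))

/-- The absolutely continuous function on `[0, tf]` with initial value `a` and derivative `y`. Its
values outside `[0, tf]` depend on the representative of `y` and carry no meaning. -/
noncomputable def antideriv (a : E d) (y : L2 tf d) (t : ℝ) : E d := a + ∫ s in 0..t, y s

theorem absolutelyContinuousOnInterval_antideriv (htf : 0 ≤ tf) (a : E d) (y : L2 tf d) :
    AbsolutelyContinuousOnInterval (antideriv a y) 0 tf :=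
  (y.intervalIntegrable htf).absolutelyContinuousOnInterval_integral.of_dist_le
    fun _ _ _ _ ↦ (dist_add_left _ _ _).le

theorem continuousOn_antideriv (htf : 0 ≤ tf) (a : E d) (y : L2 tf d) :
    ContinuousOn (antideriv a y) (Icc 0 tf) := by
  simpa only [uIcc_of_le htf] using
    (absolutelyContinuousOnInterval_antideriv htf a y).continuousOn

theorem ae_hasDerivAt_antideriv (htf : 0 ≤ tf) (a : E d) (y : L2 tf d) :
    ∀ᵐ t ∂(horizon tf), HasDerivAt (antideriv a y) (y t) t := by
  filter_upwards [ae_restrict_of_ae (y.intervalIntegrable htf).ae_hasDerivAt_integral,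
    ae_restrict_mem measurableSet_Ioo] with t h ht
  exact (h (by rw [uIcc_of_le htf]; exact Ioo_subset_Icc_self ht) 0 left_mem_uIcc).const_add a

theorem eqOn_Icc_of_ae_eq_horizon (htf : 0 < tf) {c c' : ℝ → E d} (hc : ContinuousOn c (Icc 0 tf))
    (hc' : ContinuousOn c' (Icc 0 tf)) (h : c =ᵐ[horizon tf] c') : EqOn c c' (Icc 0 tf) :=
  Measure.eqOn_Icc_of_ae_eq volume htf.ne
    (by rwa [horizon, restrict_Ioo_eq_restrict_Icc] at h) hc hc'

theorem HasPointValue.unique (htf : 0 < tf) {x : L2 tf d} {t : ℝ} (ht : t ∈ Icc 0 tf) {a b : E d}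
    (ha : HasPointValue tf x t a) (hb : HasPointValue tf x t b) : a = b := by
  obtain ⟨c, hc, hxc, rfl⟩ := ha
  obtain ⟨c', hc', hxc', rfl⟩ := hb
  exact eqOn_Icc_of_ae_eq_horizon htf hc hc' (hxc.symm.trans hxc') ht

theorem HasPointValue.sub {x x' : L2 tf d} {t : ℝ} {a a' : E d} (h : HasPointValue tf x t a)
    (h' : HasPointValue tf x' t a') : HasPointValue tf (x - x') t (a - a') := by
  obtain ⟨c, hc, hxc, rfl⟩ := h
  obtain ⟨c', hc', hxc', rfl⟩ := h'
  exact ⟨c - c', hc.sub hc', (Lp.coeFn_sub x x').trans (hxc.sub hxc'), rfl⟩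

theorem HasPointValue.add {x x' : L2 tf d} {t : ℝ} {a a' : E d} (h : HasPointValue tf x t a)
    (h' : HasPointValue tf x' t a') : HasPointValue tf (x + x') t (a + a') := by
  obtain ⟨c, hc, hxc, rfl⟩ := h
  obtain ⟨c', hc', hxc', rfl⟩ := h'
  exact ⟨c + c', hc.add hc', (Lp.coeFn_add x x').trans (hxc.add hxc'), rfl⟩

theorem HasPointValue.const_smul {x : L2 tf d} {t : ℝ} {a : E d} (r : ℝ)
    (h : HasPointValue tf x t a) : HasPointValue tf (r • x) t (r • a) := by
  obtain ⟨c, hc, hxc, rfl⟩ := h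
  exact ⟨r • c, hc.const_smul r, (Lp.coeFn_smul r x).trans (hxc.const_smul r), rfl⟩

theorem integrable_smul_L2 {ψ : ℝ → ℝ} (hψ : Continuous ψ) (x : L2 tf d) :
    Integrable (fun t ↦ ψ t • x t) (horizon tf) :=
  memLp_one_iff_integrable.1
    ((Lp.memLp x).smul (p := 2) (memLp_horizon_of_continuousOn hψ.continuousOn))

theorem IsWeakDeriv.add {x x' y y' : L2 tf d} (h : IsWeakDeriv tf x y)
    (h' : IsWeakDeriv tf x' y') : IsWeakDeriv tf (x + x') (y + y') := by
  intro ψ hψ hs ht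
  have hadd : ∀ (k : ℝ → ℝ), Continuous k → ∀ u v : L2 tf d,
      ∫ t, k t • (u + v) t ∂(horizon tf) =
        ∫ t, k t • u t ∂(horizon tf) + ∫ t, k t • v t ∂(horizon tf) := fun k hk u v ↦ by
    rw [← integral_add (integrable_smul_L2 hk u) (integrable_smul_L2 hk v)]
    refine integral_congr_ae ((Lp.coeFn_add u v).mono fun t ht ↦ ?_)
    simp only [ht, Pi.add_apply, smul_add]
  rw [hadd _ (hψ.continuous_deriv (by simp)), hadd _ hψ.continuous, h ψ hψ hs ht, h' ψ hψ hs ht,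
    neg_add]

theorem IsWeakDeriv.const_smul {x y : L2 tf d} (r : ℝ) (h : IsWeakDeriv tf x y) :
    IsWeakDeriv tf (r • x) (r • y) := by
  intro ψ hψ hs ht
  have hsmul : ∀ (k : ℝ → ℝ) (u : L2 tf d),
      ∫ t, k t • (r • u) t ∂(horizon tf) = r • ∫ t, k t • u t ∂(horizon tf) := fun k u ↦ by
    rw [← integral_smul]
    refine integral_congr_ae ((Lp.coeFn_smul r u).mono fun t ht ↦ ?_)
    simp only [ht, Pi.smul_apply, smul_comm r]
  rw [hsmul, hsmul, h ψ hψ hs ht, smul_neg]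

theorem IsWeakDeriv.sub {x x' y y' : L2 tf d} (h : IsWeakDeriv tf x y)
    (h' : IsWeakDeriv tf x' y') : IsWeakDeriv tf (x - x') (y - y') := by
  simpa [sub_eq_add_neg] using h.add (h'.const_smul (-1))

theorem isWeakDeriv_of_ae_eq_antideriv (htf : 0 < tf) {x y : L2 tf d} {a : E d}
    (hx : x =ᵐ[horizon tf] antideriv a y) : IsWeakDeriv tf x y := by
  intro ψ hψ hs ht
  have hψ0 : ψ 0 = 0 := image_eq_zero_of_notMem_tsupport fun h ↦ lt_irrefl _ (ht h).1
  have hψtf : ψ tf = 0 := image_eq_zero_of_notMem_tsupport fun h ↦ lt_irrefl _ (ht h).2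
  have hψ' : Continuous (deriv ψ) := hψ.continuous_deriv (by simp)
  have hac : AbsolutelyContinuousOnInterval (fun t ↦ ψ t • antideriv a y t) 0 tf :=
    (ContDiffOn.absolutelyContinuousOnInterval (hψ.of_le (by simp)).contDiffOn).fun_smul
      (absolutelyContinuousOnInterval_antideriv htf.le a y)
  have hI := (integrable_smul_L2 hψ' x).add (integrable_smul_L2 hψ.continuous y)
  have h := hac.eq_add_integral
    (f' := fun t ↦ deriv ψ t • x t + ψ t • y t)
    ((intervalIntegrable_iff_integrableOn_Ioo_of_le htf.le).2 hI)
    (ae_mem_uIcc_of_ae_restrict_Ioo htf.le (by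
      filter_upwards [ae_hasDerivAt_antideriv htf.le a y, hx] with t h₁ h₂
      rw [h₂, add_comm]
      exact (hψ.differentiable (by simp) t).hasDerivAt.smul h₁)) tf right_mem_uIcc
  -- `ψ` vanishes at both endpoints, so there are no boundary terms
  rw [hψ0, hψtf, zero_smul, zero_smul, zero_add, ← integral_horizon htf.le,
    integral_add (integrable_smul_L2 hψ' x) (integrable_smul_L2 hψ.continuous y)] at h
  exact eq_neg_of_add_eq_zero_left h.symm

/-- The du Bois-Reymond lemma: a class with vanishing weak derivative is constant. Every test
function differs from a multiple of a fixed one by the derivative of a test function. -/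
theorem IsWeakDeriv.ae_eq_const (htf : 0 < tf) {z : L2 tf d} (h : IsWeakDeriv tf z 0) :
    ∃ a : E d, z =ᵐ[horizon tf] fun _ ↦ a := by
  -- the fixed test function `η` has integral one
  let b : ContDiffBump (tf / 2) := ⟨tf / 8, tf / 4, by positivity, by linarith⟩
  let η : ℝ → ℝ := b.normed volume
  have hηc : ContDiff ℝ ∞ η := b.contDiff_normed
  have hηint : ∫ t, η t = 1 := b.integral_normed
  have hηsupp : tsupport η = Icc (tf / 4) (3 * tf / 4) := by
    rw [b.tsupport_normed_eq, Real.closedBall_eq_Icc]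
    congr 1 <;> simp only [b] <;> ring
  refine ⟨∫ t, η t • z t ∂(horizon tf), ?_⟩
  set a := ∫ t, η t • z t ∂(horizon tf) with ha
  have hzI : Integrable (fun t ↦ z t - a) (horizon tf) :=
    ((Lp.memLp z).integrable one_le_two).sub (integrable_const a)
  have key := isOpen_Ioo (a := (0 : ℝ)) (b := tf) |>.ae_eq_zero_of_integral_contDiff_smul_eq_zero
    (μ := horizon tf) (f := fun t ↦ z t - a) (hzI.locallyIntegrable.locallyIntegrableOn _) ?_
  · filter_upwards [key, ae_restrict_mem measurableSet_Ioo] with t h₁ h₂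
    exact sub_eq_zero.1 (h₁ h₂)
  intro φ hφ hφs hφt
  set r := ∫ t, φ t
  let k : ℝ → ℝ := fun t ↦ φ t - r * η t
  have hkc : ContDiff ℝ ∞ k := hφ.sub (contDiff_const.mul hηc)
  let ψ : ℝ → ℝ := fun t ↦ ∫ s in 0..t, k s
  have hψd : ∀ t, HasDerivAt ψ (k t) t := fun t ↦
    intervalIntegral.integral_hasDerivAt_right (hkc.continuous.intervalIntegrable _ _)
      (hkc.continuous.stronglyMeasurableAtFilter _ _) hkc.continuous.continuousAt
  have hψ' : deriv ψ = k := funext fun t ↦ (hψd t).deriv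
  have hψc : ContDiff ℝ ∞ ψ :=
    contDiff_infty_iff_deriv.2 ⟨fun t ↦ (hψd t).differentiableAt, hψ' ▸ hkc⟩
  -- `k` is supported in a compact interval `[p, q] ⊆ (0, tf)` and has integral zero
  obtain ⟨p, q, hp, hq, hkpq⟩ : ∃ p q, 0 < p ∧ q < tf ∧
      Function.support k ⊆ Icc p q := by
    have hK : IsCompact (tsupport φ ∪ Icc (tf / 4) (3 * tf / 4)) := hφs.union isCompact_Icc
    have hne : (tsupport φ ∪ Icc (tf / 4) (3 * tf / 4)).Nonempty :=
      ⟨tf / 2, .inr ⟨by linarith, by linarith⟩⟩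
    have hsub : tsupport φ ∪ Icc (tf / 4) (3 * tf / 4) ⊆ Ioo 0 tf :=
      union_subset hφt fun t ht ↦ ⟨by linarith [ht.1], by linarith [ht.2]⟩
    obtain ⟨p, hp, hp'⟩ := hK.exists_isLeast hne
    obtain ⟨q, hq, hq'⟩ := hK.exists_isGreatest hne
    refine ⟨p, q, (hsub hp).1, (hsub hq).2, fun t ht ↦ ?_⟩
    have : t ∈ tsupport φ ∪ Icc (tf / 4) (3 * tf / 4) := by
      by_contra hcon
      rw [mem_union, not_or, ← hηsupp] at hcon
      exact ht (by simp [k, image_eq_zero_of_notMem_tsupport hcon.1,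
        image_eq_zero_of_notMem_tsupport hcon.2])
    exact ⟨hp' this, hq' this⟩
  have hφI : Integrable φ := hφ.continuous.integrable_of_hasCompactSupport hφs
  have hηI : Integrable η :=
    hηc.continuous.integrable_of_hasCompactSupport b.hasCompactSupport_normed
  have hkint : ∫ t, k t = 0 := by
    rw [integral_sub hφI (hηI.const_mul r), integral_const_mul, hηint, mul_one, sub_self]
  have hψsupp : Function.support ψ ⊆ Icc p q := by
    intro t ht
    by_contra hcon
    refine ht ?_
    rcases not_and_or.1 hcon with hlt | hgt
    · have : ∀ s ∈ uIcc 0 t, k s = 0 := fun s hs ↦ by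
        by_contra hk
        have h₁ := (hkpq hk).1
        have h₂ := hs.2
        rcases le_max_iff.1 h₂ with h | h <;> linarith [not_le.1 hlt]
      exact (intervalIntegral.integral_congr this).trans (by simp)
    · refine (intervalIntegral.integral_eq_integral_of_support_subset (hkpq.trans ?_)).trans hkint
      exact fun s hs ↦ ⟨hp.trans_le hs.1, hs.2.trans (not_le.1 hgt).le⟩
  have hψt : tsupport ψ ⊆ Icc p q := closure_minimal hψsupp isClosed_Icc
  have h0 := h ψ hψc (.of_support_subset_isCompact isCompact_Icc hψsupp)
    (hψt.trans fun t ht ↦ ⟨hp.trans_le ht.1, ht.2.trans_lt hq⟩)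
  have hz0 : ∫ t, ψ t • (0 : L2 tf d) t ∂(horizon tf) = 0 := by
    refine integral_eq_zero_of_ae ((Lp.coeFn_zero (E d) 2 (horizon tf)).mono fun t ht ↦ ?_)
    exact (congrArg (ψ t • ·) ht).trans (smul_zero _)
  have hφz := integrable_smul_L2 hφ.continuous z
  have hηz := integrable_smul_L2 hηc.continuous z
  have hηr : Integrable (fun t ↦ r • η t • z t) (horizon tf) := hηz.smul r
  have hφμ : ∫ t, φ t ∂(horizon tf) = r :=
    setIntegral_eq_integral_of_forall_compl_eq_zero fun t ht ↦
      image_eq_zero_of_notMem_tsupport fun h ↦ ht (hφt h)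
  rw [hz0, neg_zero, hψ'] at h0
  simp only [k, sub_smul, mul_smul] at h0
  rw [integral_sub hφz hηr, integral_smul, ← ha, sub_eq_zero] at h0
  simp only [smul_sub]
  rw [integral_sub hφz (hφI.restrict.smul_const a), integral_smul_const, hφμ, h0, sub_self]

/-- Every class with a weak derivative has an absolutely continuous representative. -/
theorem IsWeakDeriv.exists_ae_eq_antideriv (htf : 0 < tf) {x y : L2 tf d}
    (h : IsWeakDeriv tf x y) : ∃ a, x =ᵐ[horizon tf] antideriv a y := by
  have hm := memLp_horizon_of_continuousOn (continuousOn_antideriv htf.le 0 y)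
  have hX := isWeakDeriv_of_ae_eq_antideriv htf hm.coeFn_toLp
  obtain ⟨a, ha⟩ := IsWeakDeriv.ae_eq_const htf (z := x - hm.toLp _) (by simpa using h.sub hX)
  refine ⟨a, ?_⟩
  filter_upwards [ha, Lp.coeFn_sub x (hm.toLp _), hm.coeFn_toLp] with t h₁ h₂ h₃
  rw [h₁, Pi.sub_apply, h₃] at h₂
  simp only [antideriv, zero_add] at h₂ ⊢
  rw [h₂, sub_add_cancel]

theorem HasPointValue.eq_antideriv (htf : 0 < tf) {x y : L2 tf d} {a b : E d} {t : ℝ}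
    (hx : x =ᵐ[horizon tf] antideriv a y) (ht : t ∈ Icc 0 tf) (h : HasPointValue tf x t b) :
    b = antideriv a y t :=
  h.unique htf ht ⟨_, continuousOn_antideriv htf.le a y, hx, rfl⟩

theorem IsWeakDeriv.exists_hasPointValue (htf : 0 < tf) {x y : L2 tf d} (h : IsWeakDeriv tf x y)
    (t : ℝ) : ∃ a, HasPointValue tf x t a :=
  (h.exists_ae_eq_antideriv htf).elim fun a ha ↦
    ⟨_, _, continuousOn_antideriv htf.le a y, ha, rfl⟩

/-- Integration by parts in `H¹`. -/
theorem IsWeakDeriv.inner_add_inner (htf : 0 < tf) {x y l z : L2 tf d} {a a' b b' : E d}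
    (hx : IsWeakDeriv tf x y) (hx₀ : HasPointValue tf x 0 a) (hx₁ : HasPointValue tf x tf a')
    (hl : IsWeakDeriv tf l z) (hl₀ : HasPointValue tf l 0 b) (hl₁ : HasPointValue tf l tf b') :
    inner ℝ y l + inner ℝ x z = inner ℝ a' b' - inner ℝ a b := by
  obtain ⟨α, hα⟩ := hx.exists_ae_eq_antideriv htf
  obtain ⟨β, hβ⟩ := hl.exists_ae_eq_antideriv htf
  have h0 := left_mem_Icc.2 htf.le
  have h1 := right_mem_Icc.2 htf.le
  rw [hx₀.eq_antideriv htf hα h0, hx₁.eq_antideriv htf hα h1, hl₀.eq_antideriv htf hβ h0,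
    hl₁.eq_antideriv htf hβ h1, L2.inner_def, L2.inner_def,
    ← integral_add (L2.integrable_inner y l) (L2.integrable_inner x z), integral_horizon htf.le]
  have := ((absolutelyContinuousOnInterval_antideriv htf.le α y).inner
    (absolutelyContinuousOnInterval_antideriv htf.le β z)).eq_add_integral
    (f' := fun t ↦ inner ℝ (y t) (l t) + inner ℝ (x t) (z t))
    ((intervalIntegrable_iff_integrableOn_Ioo_of_le htf.le).2
      ((L2.integrable_inner y l).add (L2.integrable_inner x z)))
    (ae_mem_uIcc_of_ae_restrict_Ioo htf.le (by
      filter_upwards [ae_hasDerivAt_antideriv htf.le α y, ae_hasDerivAt_antideriv htf.le β z,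
        hα, hβ] with t h₁ h₂ h₃ h₄
      rw [h₃, h₄, add_comm]
      exact h₁.inner ℝ h₂)) tf right_mem_uIcc
  linarith

end WeakDeriv

/-! ### Linear differential equations with square integrable forcing -/

section LinearODE

variable {tf : ℝ} {d : ℕ}

theorem exp_smul_mul_exp_neg_smul {F : Type*} [NormedAddCommGroup F] [NormedSpace ℝ F]
    [CompleteSpace F] (A : F →L[ℝ] F) (t : ℝ) :
    NormedSpace.exp (t • A) * NormedSpace.exp ((-t) • A) = 1 := by
  let := NormedAlgebra.restrictScalars ℚ ℝ (F →L[ℝ] F)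
  rw [← NormedSpace.exp_add_of_commute ((Commute.refl A).smul_left t |>.smul_right (-t)),
    ← add_smul, add_neg_cancel, zero_smul, NormedSpace.exp_zero]

theorem hasDerivAt_exp_smul_apply {F : Type*} [NormedAddCommGroup F] [NormedSpace ℝ F]
    [CompleteSpace F] (A : F →L[ℝ] F) {w : ℝ → F} {f : F} {t : ℝ}
    (hw : HasDerivAt w (NormedSpace.exp ((-t) • A) f) t) :
    HasDerivAt (fun t ↦ NormedSpace.exp (t • A) (w t))
      (A (NormedSpace.exp (t • A) (w t)) + f) t := by
  have := (hasDerivAt_exp_smul_const' (𝕂 := ℝ) A t).clm_apply hw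
  rwa [← mul_apply_eq_comp (NormedSpace.exp (t • A)), exp_smul_mul_exp_neg_smul] at this

/-- Solvability of `ẋ = A x + f` with a prescribed value at `t₀`, by variation of constants. The
interest is in `t₀ ∈ [0, tf]`; elsewhere `HasPointValue` does not tie the value to the class. -/
theorem exists_isWeakDeriv_compLp_add (htf : 0 < tf) (A : E d →L[ℝ] E d) (f : L2 tf d) (t₀ : ℝ)
    (b : E d) :
    ∃ x : L2 tf d, IsWeakDeriv tf x (A.compLp x + f) ∧ HasPointValue tf x t₀ b := by
  let Φ : ℝ → E d →L[ℝ] E d := fun t ↦ NormedSpace.exp (t • A)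
  have hΦ : Continuous Φ := continuous_iff_continuousAt.2 fun t ↦
    (hasDerivAt_exp_smul_const (𝕂 := ℝ) A t).continuousAt
  have hΦd : ContDiff ℝ 1 Φ := by
    have hd := fun t ↦ hasDerivAt_exp_smul_const (𝕂 := ℝ) A t
    refine contDiff_one_iff_deriv.2 ⟨fun t ↦ (hd t).differentiableAt, ?_⟩
    rw [show deriv Φ = fun t ↦ Φ t * A from funext fun t ↦ (hd t).deriv]
    exact hΦ.mul continuous_const
  -- the equation is integrated after pairing with a fixed vector `q`, which turns the product
  -- `Φ t (w t)` into an inner product of two absolutely continuous functions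
  have hΦac : ∀ q : E d,
      AbsolutelyContinuousOnInterval (fun t ↦ ContinuousLinearMap.adjoint (Φ t) q) 0 tf := by
    intro q
    refine (hΦd.contDiffOn.absolutelyContinuousOnInterval.const_smul ‖q‖).of_dist_le
      fun s _ t _ ↦ ?_
    rw [dist_eq_norm, dist_smul₀, norm_norm, dist_eq_norm, mul_comm, ← LinearIsometryEquiv.norm_map
      ContinuousLinearMap.adjoint (Φ s - Φ t), map_sub, ← sub_apply]
    exact ContinuousLinearMap.le_opNorm _ _
  have hΦn : Continuous fun t ↦ Φ (-t) := hΦ.comp continuous_neg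
  have hgI : IntervalIntegrable (fun s ↦ Φ (-s) (f s)) volume 0 tf := by
    obtain ⟨C, hC⟩ := isCompact_Icc (a := 0) (b := tf) |>.exists_bound_of_continuousOn
      hΦn.continuousOn
    refine (intervalIntegrable_iff_integrableOn_Ioo_of_le htf.le).2 ?_
    refine (((Lp.memLp f).integrable one_le_two).norm.const_mul C).mono'
      ((ContinuousLinearMap.id ℝ (E d →L[ℝ] E d)).aestronglyMeasurable_comp₂
        hΦn.aestronglyMeasurable (Lp.aestronglyMeasurable f)) ?_
    filter_upwards [ae_restrict_mem measurableSet_Ioo] with t ht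
    exact (ContinuousLinearMap.le_opNorm _ _).trans
      (mul_le_mul_of_nonneg_right (hC t (Ioo_subset_Icc_self ht)) (norm_nonneg _))
  set c : E d := Φ (-t₀) b - ∫ s in 0..t₀, Φ (-s) (f s) with hc
  let w : ℝ → E d := fun t ↦ c + ∫ s in 0..t, Φ (-s) (f s)
  have hwac : AbsolutelyContinuousOnInterval w 0 tf :=
    hgI.absolutelyContinuousOnInterval_integral.of_dist_le fun _ _ _ _ ↦ (dist_add_left _ _ _).le
  have hwc : ContinuousOn w (Icc 0 tf) := by simpa only [uIcc_of_le htf.le] using hwac.continuousOn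
  let y : ℝ → E d := fun t ↦ Φ t (w t)
  have hyc : ContinuousOn y (Icc 0 tf) := hΦ.continuousOn.clm_apply hwc
  have hyd : ∀ᵐ t ∂(horizon tf), HasDerivAt y (A (y t) + f t) t := by
    filter_upwards [ae_restrict_of_ae hgI.ae_hasDerivAt_integral,
      ae_restrict_mem measurableSet_Ioo] with t h ht
    exact hasDerivAt_exp_smul_apply A
      ((h (by rw [uIcc_of_le htf.le]; exact Ioo_subset_Icc_self ht) 0 left_mem_uIcc).const_add c)
  have hm := memLp_horizon_of_continuousOn hyc
  set x : L2 tf d := hm.toLp y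
  have hxy : x =ᵐ[horizon tf] y := hm.coeFn_toLp
  have hx' : (A.compLp x + f : L2 tf d) =ᵐ[horizon tf] fun t ↦ A (y t) + f t := by
    filter_upwards [Lp.coeFn_add (A.compLp x) f, A.coeFn_compLp x, hxy] with t h₁ h₂ h₃
    rw [h₁, Pi.add_apply, h₂, h₃]
  have hII := L2.intervalIntegrable htf.le (A.compLp x + f)
  have hyeq : ∀ t ∈ Icc 0 tf, y t = antideriv (y 0) (A.compLp x + f) t := by
    intro t ht
    have hII' : IntervalIntegrable (A.compLp x + f : L2 tf d) volume 0 t :=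
      hII.mono_set (uIcc_subset_uIcc left_mem_uIcc (by rwa [uIcc_of_le htf.le]))
    refine ext_inner_left ℝ fun q ↦ ?_
    have hac : AbsolutelyContinuousOnInterval (fun t ↦ inner ℝ q (y t)) 0 tf := by
      have := (hΦac q).inner hwac
      simpa only [ContinuousLinearMap.adjoint_inner_left] using this
    have h := hac.eq_add_integral (f' := fun t ↦ inner ℝ q ((A.compLp x + f : L2 tf d) t))
      ⟨hII.1.const_inner q, hII.2.const_inner q⟩ (ae_mem_uIcc_of_ae_restrict_Ioo htf.le (by
        filter_upwards [hyd, hx'] with t h₁ h₂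
        rw [h₂]
        exact (innerSL ℝ q).hasFDerivAt.comp_hasDerivAt t h₁)) t (by rwa [uIcc_of_le htf.le])
    rw [h, antideriv, inner_add_right]
    congr 1
    exact (innerSL ℝ q).intervalIntegral_comp_comm hII'
  have hae : x =ᵐ[horizon tf] antideriv (y 0) (A.compLp x + f) := by
    filter_upwards [hxy, ae_restrict_mem measurableSet_Ioo] with t h ht
    rw [h, hyeq t (Ioo_subset_Icc_self ht)]
  refine ⟨x, isWeakDeriv_of_ae_eq_antideriv htf hae, y, hyc, hxy, ?_⟩
  simp only [y, w, hc, sub_add_cancel]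
  rw [← mul_apply_eq_comp, exp_smul_mul_exp_neg_smul, one_apply_eq_self]

theorem inner_compLp_adjoint {n m : ℕ} (B : E m →L[ℝ] E n) (u : L2 tf m) (l : L2 tf n) :
    inner ℝ u ((ContinuousLinearMap.adjoint B).compLp l) = inner ℝ (B.compLp u) l := by
  rw [L2.inner_def, L2.inner_def]
  refine integral_congr_ae ?_
  filter_upwards [(ContinuousLinearMap.adjoint B).coeFn_compLp l, B.coeFn_compLp u] with t h₁ h₂
  rw [h₁, h₂, ContinuousLinearMap.adjoint_inner_right]

theorem ContinuousLinearMap.neg_compLp {n m : ℕ} (B : E m →L[ℝ] E n) (u : L2 tf m) :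
    (-B).compLp u = -B.compLp u := by
  simpa using B.smul_compLp (-1 : ℝ) u

/-- A linear equation and its adjoint are in duality. -/
theorem inner_add_inner_of_adjoint (htf : 0 < tf) (A : E d →L[ℝ] E d) {x f l g : L2 tf d}
    {a a' b b' : E d} (hx : IsWeakDeriv tf x (A.compLp x + f))
    (hx₀ : HasPointValue tf x 0 a) (hx₁ : HasPointValue tf x tf a')
    (hl : IsWeakDeriv tf l ((-ContinuousLinearMap.adjoint A).compLp l + g))
    (hl₀ : HasPointValue tf l 0 b) (hl₁ : HasPointValue tf l tf b') :
    inner ℝ f l + inner ℝ x g = inner ℝ a' b' - inner ℝ a b := by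
  rw [← hx.inner_add_inner htf hx₀ hx₁ hl hl₀ hl₁, inner_add_left, inner_add_right,
    A.adjoint.neg_compLp, inner_neg_right, inner_compLp_adjoint]
  ring

/-- Uniqueness for homogeneous linear equations, by testing with solutions of the adjoint equation
whose boundary value vanishes at the other endpoint. -/
theorem eq_zero_of_isWeakDeriv_compLp (htf : 0 < tf) (A : E d →L[ℝ] E d) {x : L2 tf d}
    (hx : IsWeakDeriv tf x (A.compLp x))
    (h : HasPointValue tf x 0 0 ∨ HasPointValue tf x tf 0) : x = 0 := by
  obtain ⟨a, ha⟩ := hx.exists_hasPointValue htf 0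
  obtain ⟨a', ha'⟩ := hx.exists_hasPointValue htf tf
  rw [← add_zero (A.compLp x)] at hx
  refine inner_self_eq_zero (𝕜 := ℝ).1 ?_
  rcases h with h | h
  · obtain ⟨l, hl, hl₁⟩ := exists_isWeakDeriv_compLp_add htf (-A.adjoint) x tf 0
    obtain ⟨b, hb⟩ := hl.exists_hasPointValue htf 0
    simpa using inner_add_inner_of_adjoint htf A hx h ha' hl hb hl₁
  · obtain ⟨l, hl, hl₀⟩ := exists_isWeakDeriv_compLp_add htf (-A.adjoint) x 0 0
    obtain ⟨b, hb⟩ := hl.exists_hasPointValue htf tf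
    simpa using inner_add_inner_of_adjoint htf A hx ha h hl hl₀ hb

end LinearODE

/-! ### Metric projections -/

section Projection

variable {X : Type*} [NormedAddCommGroup X] [InnerProductSpace ℝ X] {K : Set X}

theorem norm_sub_sq_add_le_of_inner_le_zero {x p q : X} (h : inner ℝ (x - p) (q - p) ≤ 0) :
    ‖x - p‖ ^ 2 + ‖q - p‖ ^ 2 ≤ ‖x - q‖ ^ 2 := by
  have : x - q = (x - p) - (q - p) := by abel
  rw [this, norm_sub_sq_real (x - p)]
  linarith

theorem proj_eq_of_inner_le_zero {x p : X} (hp : p ∈ K)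
    (h : ∀ q ∈ K, inner ℝ (x - p) (q - p) ≤ 0) : proj K x = p := by
  have hex : ∃ p ∈ K, ∀ q ∈ K, ‖x - p‖ ≤ ‖x - q‖ := ⟨p, hp, fun q hq ↦
    le_of_sq_le_sq (by nlinarith [norm_sub_sq_add_le_of_inner_le_zero (h q hq), sq_nonneg ‖q - p‖])
      (norm_nonneg _)⟩
  rw [proj, dif_pos hex]
  obtain ⟨hm, hmin⟩ := hex.choose_spec
  have h₁ := norm_sub_sq_add_le_of_inner_le_zero (h _ hm)
  have h₂ := pow_le_pow_left₀ (norm_nonneg _) (hmin p hp) 2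
  exact sub_eq_zero.1 (norm_eq_zero.1 (pow_eq_zero_iff two_ne_zero |>.1
    (le_antisymm (by linarith) (sq_nonneg _))))

theorem proj_spec [CompleteSpace X] (hK : Convex ℝ K) (hc : IsClosed K) (hne : K.Nonempty) (x : X) :
    proj K x ∈ K ∧ ∀ q ∈ K, inner ℝ (x - proj K x) (q - proj K x) ≤ 0 := by
  obtain ⟨p, hp, hmin⟩ := exists_norm_eq_iInf_of_complete_convex hne hc.isComplete hK x
  have h := (norm_eq_iInf_iff_real_inner_le_zero hK hp).1 hmin
  rw [proj_eq_of_inner_le_zero hp h]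
  exact ⟨hp, h⟩

theorem lipschitzWith_proj [CompleteSpace X] (hK : Convex ℝ K) (hc : IsClosed K)
    (hne : K.Nonempty) : LipschitzWith 1 (proj K) := by
  refine LipschitzWith.of_dist_le_mul fun x y ↦ ?_
  rw [NNReal.coe_one, one_mul, dist_eq_norm, dist_eq_norm]
  obtain ⟨hx, hx'⟩ := proj_spec hK hc hne x
  obtain ⟨hy, hy'⟩ := proj_spec hK hc hne y
  set p := proj K x
  set q := proj K y
  have h₁ := hx' q hy
  have h₂ := hy' p hx
  have h₃ : ‖p - q‖ ^ 2 ≤ inner ℝ (x - y) (p - q) := by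
    have : inner ℝ (x - y) (p - q) = ‖p - q‖ ^ 2 - inner ℝ (x - p) (q - p) -
        inner ℝ (y - q) (p - q) := by
      rw [← real_inner_self_eq_norm_sq, ← neg_sub p q, inner_neg_right]
      simp only [inner_sub_left]
      ring
    linarith
  have h₄ := real_inner_le_norm (x - y) (p - q)
  by_contra hlt
  push Not at hlt
  nlinarith [norm_nonneg (x - y), norm_nonneg (p - q)]

end Projection

section ControlSet

variable {tf : ℝ} {d : ℕ} {U : Set (E d)}

theorem convex_controlSet (hU : Convex ℝ U) : Convex ℝ (controlSet tf U) := by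
  intro u hu v hv a b ha hb hab
  filter_upwards [hu, hv, Lp.coeFn_add (a • u) (b • v), Lp.coeFn_smul a u, Lp.coeFn_smul b v]
    with t h₁ h₂ h₃ h₄ h₅
  rw [h₃, Pi.add_apply, h₄, h₅]
  exact hU h₁ h₂ ha hb hab

theorem isClosed_controlSet (hU : IsClosed U) : IsClosed (controlSet tf U) := by
  refine IsSeqClosed.isClosed fun u v hu huv ↦ ?_
  obtain ⟨s, -, hs⟩ := (tendstoInMeasure_of_tendsto_Lp huv).exists_seq_tendsto_ae
  filter_upwards [hs, ae_all_iff.2 fun k ↦ hu (s k)] with t h₁ h₂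
  exact hU.mem_of_tendsto h₁ (Eventually.of_forall h₂)

theorem const_mem_controlSet {c : E d} (hc : c ∈ U) :
    Lp.const 2 (horizon tf) c ∈ controlSet tf U := by
  filter_upwards [Lp.coeFn_const (p := 2) (μ := horizon tf) c] with t ht
  rw [ht]; exact hc

/-- The projection onto the controls with values in `U` is the pointwise projection onto `U`. -/
theorem proj_controlSet_ae_eq (hc : IsClosed U) (hU : Convex ℝ U) (hne : U.Nonempty)
    (p : L2 tf d) :
    (proj (controlSet tf U) p : L2 tf d) =ᵐ[horizon tf] fun t ↦ proj U (p t) := by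
  have hlip := lipschitzWith_proj hU hc hne
  have hm : MemLp (fun t ↦ proj U (p t)) 2 (horizon tf) := by
    have h₀ : MemLp (fun t ↦ proj U (p t) - proj U 0) 2 (horizon tf) :=
      (Lp.memLp p).mono ((hlip.continuous.comp_aestronglyMeasurable
        (Lp.aestronglyMeasurable p)).sub aestronglyMeasurable_const)
        (ae_of_all _ fun t ↦ by simpa [dist_eq_norm] using hlip.dist_le_mul (p t) 0)
    simpa [Pi.add_def] using h₀.add (memLp_const (proj U 0))
  have hu : hm.toLp _ ∈ controlSet tf U := by
    filter_upwards [hm.coeFn_toLp] with t ht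
    rw [ht]; exact (proj_spec hU hc hne _).1
  rw [proj_eq_of_inner_le_zero hu]
  · exact hm.coeFn_toLp
  intro v hv
  rw [L2.inner_def]
  refine integral_nonpos_of_ae ?_
  filter_upwards [hv, hm.coeFn_toLp, Lp.coeFn_sub p (hm.toLp _), Lp.coeFn_sub v (hm.toLp _)]
    with t h₁ h₂ h₃ h₄
  rw [h₃, h₄, Pi.sub_apply, Pi.sub_apply, h₂]
  exact (proj_spec hU hc hne _).2 _ h₁

end ControlSet

/-! ### The optimality system -/

section OptimalControl

variable {n m : ℕ} {tf α : ℝ} {xref : E n} {uref : E m} {A : E n →L[ℝ] E n} {B : E m →L[ℝ] E n}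
  {U : Set (E m)} {x₀ : E n}

theorem cost_eq (x : L2 tf n) (u : L2 tf m) :
    cost tf α xref uref x u = 1 / 2 * ‖x - Lp.const 2 (horizon tf) xref‖ ^ 2 +
      α / 2 * ‖u - Lp.const 2 (horizon tf) uref‖ ^ 2 := by
  have h : ∀ {d : ℕ} (z : L2 tf d) (c : E d),
      (fun t ↦ ‖z t - c‖ ^ 2) =ᵐ[horizon tf] fun t ↦ inner ℝ
        ((z - Lp.const 2 (horizon tf) c : L2 tf d) t)
        ((z - Lp.const 2 (horizon tf) c : L2 tf d) t) :=
    fun z c ↦ by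
    filter_upwards [Lp.coeFn_sub z (Lp.const 2 (horizon tf) c),
      Lp.coeFn_const (p := 2) (μ := horizon tf) c] with t h₁ h₂
    rw [h₁, Pi.sub_apply, h₂, real_inner_self_eq_norm_sq, Function.const_apply]
  have hx := (L2.integrable_inner (𝕜 := ℝ) _ _).congr (h x xref).symm
  have hu := (L2.integrable_inner (𝕜 := ℝ) _ _).congr (h u uref).symm
  rw [cost, integral_add (hx.const_mul _) (hu.const_mul _), integral_const_mul, integral_const_mul,
    integral_congr_ae (h x xref), integral_congr_ae (h u uref), ← L2.inner_def, ← L2.inner_def,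
    real_inner_self_eq_norm_sq, real_inner_self_eq_norm_sq]

/-- `x` is a trajectory of the linear control system `ẋ = A x + B u` with `x(0) = x₀` and
control `u`. -/
def IsTrajectory (tf : ℝ) (A : E n →L[ℝ] E n) (B : E m →L[ℝ] E n) (x₀ : E n) (x : L2 tf n)
    (u : L2 tf m) : Prop :=
  IsWeakDeriv tf x (A.compLp x + B.compLp u) ∧ HasPointValue tf x 0 x₀

theorem isFeasible_iff {F : Set (L2 tf m)} {x : L2 tf n} {u : L2 tf m} :
    IsFeasible tf A B F x₀ x u ↔ IsTrajectory tf A B x₀ x u ∧ u ∈ F := by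
  have hae : (A.compLp x + B.compLp u : L2 tf n) =ᵐ[horizon tf] fun t ↦ A (x t) + B (u t) := by
    filter_upwards [Lp.coeFn_add (A.compLp x) (B.compLp u), A.coeFn_compLp x, B.coeFn_compLp u]
      with t h₁ h₂ h₃
    rw [h₁, Pi.add_apply, h₂, h₃]
  constructor
  · rintro ⟨⟨y, hy, hyae⟩, h₀, hu⟩
    rw [Lp.ext (hyae.trans hae.symm)] at hy
    exact ⟨⟨hy, h₀⟩, hu⟩
  · rintro ⟨⟨hy, h₀⟩, hu⟩
    exact ⟨⟨_, hy, hae⟩, h₀, hu⟩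

theorem exists_isTrajectory (htf : 0 < tf) (A : E n →L[ℝ] E n) (B : E m →L[ℝ] E n) (x₀ : E n)
    (u : L2 tf m) : ∃ x, IsTrajectory tf A B x₀ x u :=
  exists_isWeakDeriv_compLp_add htf A (B.compLp u) 0 x₀

theorem ContinuousLinearMap.compLp_sub' (B : E m →L[ℝ] E n) (u v : L2 tf m) :
    B.compLp (u - v) = B.compLp u - B.compLp v :=
  (B.compLpL 2 (horizon tf)).map_sub u v

theorem ContinuousLinearMap.compLp_add' (B : E m →L[ℝ] E n) (u v : L2 tf m) :
    B.compLp (u + v) = B.compLp u + B.compLp v :=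
  (B.compLpL 2 (horizon tf)).map_add u v

theorem ContinuousLinearMap.compLp_smul' (B : E m →L[ℝ] E n) (r : ℝ) (u : L2 tf m) :
    B.compLp (r • u) = r • B.compLp u :=
  (B.compLpL 2 (horizon tf)).map_smul r u

theorem IsTrajectory.sub {x y : L2 tf n} {u v : L2 tf m} {y₀ : E n}
    (h : IsTrajectory tf A B x₀ x u) (h' : IsTrajectory tf A B y₀ y v) :
    IsTrajectory tf A B (x₀ - y₀) (x - y) (u - v) := by
  refine ⟨?_, h.2.sub h'.2⟩
  convert h.1.sub h'.1 using 1
  rw [A.compLp_sub', B.compLp_sub']; abel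

theorem IsTrajectory.add {x y : L2 tf n} {u v : L2 tf m} {y₀ : E n}
    (h : IsTrajectory tf A B x₀ x u) (h' : IsTrajectory tf A B y₀ y v) :
    IsTrajectory tf A B (x₀ + y₀) (x + y) (u + v) := by
  refine ⟨?_, h.2.add h'.2⟩
  convert h.1.add h'.1 using 1
  rw [A.compLp_add', B.compLp_add']; abel

theorem IsTrajectory.const_smul {x : L2 tf n} {u : L2 tf m} (r : ℝ)
    (h : IsTrajectory tf A B x₀ x u) : IsTrajectory tf A B (r • x₀) (r • x) (r • u) := by
  refine ⟨?_, h.2.const_smul r⟩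
  convert h.1.const_smul r using 1
  rw [A.compLp_smul', B.compLp_smul', smul_add]

/-- The adjoint equation `λ̇ = -A* λ + g` with terminal value `λ(tf) = 0` represents the functional
`x ↦ ⟪x, g⟫` on trajectories. -/
theorem IsTrajectory.inner_eq (htf : 0 < tf) {x l g : L2 tf n} {u : L2 tf m} {l₀ : E n}
    (h : IsTrajectory tf A B x₀ x u) (hl : IsWeakDeriv tf l ((-A.adjoint).compLp l + g))
    (hl₀ : HasPointValue tf l 0 l₀) (hl₁ : HasPointValue tf l tf 0) :
    inner ℝ x g = -inner ℝ u (B.adjoint.compLp l) - inner ℝ x₀ l₀ := by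
  obtain ⟨a, ha⟩ := h.1.exists_hasPointValue htf tf
  have := inner_add_inner_of_adjoint htf A h.1 h.2 ha hl hl₀ hl₁
  rw [inner_zero_right, zero_sub] at this
  rw [inner_compLp_adjoint]
  linarith

/-- The trajectories with fixed initial value form a closed set: by duality they are cut out by
continuous affine equations, one for each right-hand side of the adjoint equation. -/
theorem isClosed_setOf_isTrajectory (htf : 0 < tf) (A : E n →L[ℝ] E n) (B : E m →L[ℝ] E n)
    (x₀ : E n) : IsClosed {p : L2 tf n × L2 tf m | IsTrajectory tf A B x₀ p.1 p.2} := by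
  choose l hl hl₁ using fun g : L2 tf n ↦
    exists_isWeakDeriv_compLp_add htf (-A.adjoint) g tf 0
  choose l₀ hl₀ using fun g ↦ (hl g).exists_hasPointValue htf 0
  have : {p : L2 tf n × L2 tf m | IsTrajectory tf A B x₀ p.1 p.2} =
      ⋂ g, {p | inner ℝ p.1 g = -inner ℝ p.2 (B.adjoint.compLp (l g)) - inner ℝ x₀ (l₀ g)} := by
    ext ⟨x, u⟩
    simp only [mem_ofPred_eq, mem_iInter]
    refine ⟨fun h g ↦ h.inner_eq htf (hl g) (hl₀ g) (hl₁ g), fun h ↦ ?_⟩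
    obtain ⟨y, hy⟩ := exists_isTrajectory htf A B x₀ u
    have : x = y := ext_inner_right ℝ fun g ↦ by
      rw [h g, hy.inner_eq htf (hl g) (hl₀ g) (hl₁ g)]
    exact this ▸ hy
  rw [this]
  exact isClosed_iInter fun g ↦ isClosed_eq (by fun_prop) (by fun_prop)

/-- The optimality system that `M_{opt,0} w = (0, 0, -x₀)` stands for, with `w = (x, λ, λ₀)`: the
state equation with the control `P_F (α⁻¹ B* λ + uref)`, the adjoint equation, and the boundary
conditions of `λ`. -/
structure IsOptimalitySolution (tf α : ℝ) (xref : E n) (uref : E m) (A : E n →L[ℝ] E n)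
    (B : E m →L[ℝ] E n) (U : Set (E m)) (x₀ : E n) (w : W tf n) : Prop where
  state : IsTrajectory tf A B x₀ w.1 (reducedControl tf α B uref (controlSet tf U) w.2.1)
  costate : IsWeakDeriv tf w.2.1
    ((-A.adjoint).compLp w.2.1 + (w.1 - Lp.const 2 (horizon tf) xref))
  initial : HasPointValue tf w.2.1 0 w.2.2
  terminal : HasPointValue tf w.2.1 tf 0

theorem mem_Mopt_iff {w : W tf n} :
    (w, -embed tf x₀) ∈ Mopt tf α xref uref A B (controlSet tf U) 0 ↔
      IsOptimalitySolution tf α xref uref A B U x₀ w := by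
  obtain ⟨x, l, l₀⟩ := w
  constructor
  · rintro ⟨x', l', ξ, hx, hξ, hl, hl₀, hl₁, h₁, h₂, h₃⟩
    simp only [embed] at h₁ h₂ h₃
    have h₁' : l' = (-A.adjoint).compLp l + (x - Lp.const 2 (horizon tf) xref) := by
      rw [A.adjoint.neg_compLp]
      have : (0 : L2 tf n) = _ := neg_zero.symm.trans h₁
      rw [← sub_eq_zero, ← neg_eq_zero, this]; abel
    have h₂' : x' = A.compLp x +
        B.compLp (reducedControl tf α B uref (controlSet tf U) l) := by
      have : (0 : L2 tf n) = _ := neg_zero.symm.trans h₂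
      rw [← sub_eq_zero, ← neg_eq_zero, this]; abel
    have h₃' : ξ = x₀ := by
      rw [add_zero] at h₃
      exact (neg_injective h₃).symm
    exact ⟨⟨h₂' ▸ hx, h₃' ▸ hξ⟩, h₁' ▸ hl, hl₀, hl₁⟩
  · rintro ⟨⟨hx, hx₀⟩, hl, hl₀, hl₁⟩
    refine ⟨_, _, x₀, hx, hx₀, hl, hl₀, hl₁, ?_, ?_, ?_⟩
    · rw [A.adjoint.neg_compLp]
      exact neg_zero.trans (by abel)
    · exact neg_zero.trans (by abel)
    · exact (add_zero _).symm

/-- The defining variational inequality of the reduced control. -/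
theorem inner_reducedControl_le (hα : 0 < α) (hc : IsClosed U) (hU : Convex ℝ U) (huref : uref ∈ U)
    (l : L2 tf n) {u : L2 tf m} (hu : u ∈ controlSet tf U) :
    inner ℝ (u - reducedControl tf α B uref (controlSet tf U) l) (B.adjoint.compLp l) ≤
      α * inner ℝ (u - reducedControl tf α B uref (controlSet tf U) l)
        (reducedControl tf α B uref (controlSet tf U) l - Lp.const 2 (horizon tf) uref) := by
  have h := (proj_spec (convex_controlSet hU) (isClosed_controlSet hc)
    ⟨_, const_mem_controlSet huref⟩
    ((1 / α) • B.adjoint.compLp l + Lp.const 2 (horizon tf) uref)).2 u hu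
  change inner ℝ (_ - reducedControl tf α B uref (controlSet tf U) l)
    (u - reducedControl tf α B uref (controlSet tf U) l) ≤ 0 at h
  set r := reducedControl tf α B uref (controlSet tf U) l
  rw [show (1 / α) • B.adjoint.compLp l + Lp.const 2 (horizon tf) uref - r =
    (1 / α) • B.adjoint.compLp l - (r - Lp.const 2 (horizon tf) uref) by abel, real_inner_comm,
    inner_sub_right, inner_smul_right, sub_nonpos, one_div, inv_mul_le_iff₀ hα] at h
  exact h

/-- The variational inequality characterizes the reduced control. -/
theorem reducedControl_eq_of_inner_le (hα : 0 < α) {l : L2 tf n} {r : L2 tf m}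
    (hr : r ∈ controlSet tf U)
    (h : ∀ u ∈ controlSet tf U, inner ℝ (u - r) (B.adjoint.compLp l) ≤
      α * inner ℝ (u - r) (r - Lp.const 2 (horizon tf) uref)) :
    reducedControl tf α B uref (controlSet tf U) l = r := by
  refine proj_eq_of_inner_le_zero hr fun u hu ↦ ?_
  rw [show (1 / α) • B.adjoint.compLp l + Lp.const 2 (horizon tf) uref - r =
    (1 / α) • B.adjoint.compLp l - (r - Lp.const 2 (horizon tf) uref) by abel, real_inner_comm,
    inner_sub_right, inner_smul_right, sub_nonpos, one_div, inv_mul_le_iff₀ hα]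
  exact h u hu

theorem reducedControl_mem (hc : IsClosed U) (hU : Convex ℝ U) (huref : uref ∈ U) (l : L2 tf n) :
    reducedControl tf α B uref (controlSet tf U) l ∈ controlSet tf U :=
  (proj_spec (convex_controlSet hU) (isClosed_controlSet hc) ⟨_, const_mem_controlSet huref⟩ _).1

/-- The reduced control is the pointwise feedback of the costate; hence it has a continuous
representative when the costate has one. -/
theorem hasPointValue_reducedControl (hc : IsClosed U) (hU : Convex ℝ U) (huref : uref ∈ U)
    {l : L2 tf n} {t : ℝ} {q : E n} (h : HasPointValue tf l t q) :
    HasPointValue tf (reducedControl tf α B uref (controlSet tf U) l) t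
      (feedback α B uref U q) := by
  obtain ⟨c, hcont, hlc, rfl⟩ := h
  have hP := (lipschitzWith_proj hU hc ⟨_, huref⟩).continuous
  refine ⟨fun t ↦ feedback α B uref U (c t), ?_, ?_, rfl⟩
  · unfold feedback
    fun_prop
  · filter_upwards [proj_controlSet_ae_eq hc hU ⟨_, huref⟩
        ((1 / α) • B.adjoint.compLp l + Lp.const 2 (horizon tf) uref),
      Lp.coeFn_add ((1 / α) • B.adjoint.compLp l) (Lp.const 2 (horizon tf) uref),
      Lp.coeFn_smul (1 / α) (B.adjoint.compLp l), B.adjoint.coeFn_compLp l,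
      Lp.coeFn_const (p := 2) (μ := horizon tf) uref, hlc] with t h₁ h₂ h₃ h₄ h₅ h₆
    rw [reducedControl, h₁, h₂, Pi.add_apply, h₃, Pi.smul_apply, h₄, h₅, h₆, feedback,
      Function.const_apply]

/-- The cost grows quadratically away from a solution of the optimality system. -/
theorem IsOptimalitySolution.cost_add_le (htf : 0 < tf) (hα : 0 < α) (hc : IsClosed U)
    (hU : Convex ℝ U) (huref : uref ∈ U) {w : W tf n}
    (h : IsOptimalitySolution tf α xref uref A B U x₀ w) {x : L2 tf n} {u : L2 tf m}
    (hx : IsTrajectory tf A B x₀ x u) (hu : u ∈ controlSet tf U) :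
    cost tf α xref uref w.1 (reducedControl tf α B uref (controlSet tf U) w.2.1) +
      (1 / 2 * ‖x - w.1‖ ^ 2 +
        α / 2 * ‖u - reducedControl tf α B uref (controlSet tf U) w.2.1‖ ^ 2) ≤
      cost tf α xref uref x u := by
  have h₁ := inner_reducedControl_le (B := B) hα hc hU huref w.2.1 hu
  have h₂ := (hx.sub h.state).inner_eq htf h.costate h.initial h.terminal
  set r := reducedControl tf α B uref (controlSet tf U) w.2.1
  set X := Lp.const 2 (horizon tf) xref
  set Y := Lp.const 2 (horizon tf) uref
  rw [sub_self, inner_zero_left, sub_zero] at h₂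
  rw [cost_eq, cost_eq, show x - X = (x - w.1) + (w.1 - X) by abel,
    show u - Y = (u - r) + (r - Y) by abel, norm_add_sq_real (x - w.1), norm_add_sq_real (u - r)]
  linarith

theorem IsOptimalitySolution.isOptimal_iff (htf : 0 < tf) (hα : 0 < α) (hc : IsClosed U)
    (hU : Convex ℝ U) (huref : uref ∈ U) {w : W tf n}
    (h : IsOptimalitySolution tf α xref uref A B U x₀ w) {x : L2 tf n} {u : L2 tf m} :
    IsOptimal tf α xref uref A B (controlSet tf U) x₀ x u ↔
      x = w.1 ∧ u = reducedControl tf α B uref (controlSet tf U) w.2.1 := by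
  have hfeas := isFeasible_iff.2 ⟨h.state, reducedControl_mem hc hU huref w.2.1⟩
  constructor
  · rintro ⟨hxu, hmin⟩
    rw [isFeasible_iff] at hxu
    have h₁ := h.cost_add_le htf hα hc hU huref hxu.1 hxu.2
    have h₂ := hmin _ _ hfeas
    set r := reducedControl tf α B uref (controlSet tf U) w.2.1
    have h₃ : 0 ≤ α / 2 * ‖u - r‖ ^ 2 := by positivity
    have h₄ : ‖x - w.1‖ ^ 2 = 0 := le_antisymm (by linarith) (sq_nonneg _)
    have h₅ : ‖u - r‖ ^ 2 = 0 := by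
      have : α / 2 * ‖u - r‖ ^ 2 = 0 := le_antisymm (by linarith [sq_nonneg ‖x - w.1‖]) h₃
      exact (mul_eq_zero.1 this).resolve_left (by positivity)
    exact ⟨sub_eq_zero.1 (norm_eq_zero.1 (pow_eq_zero_iff two_ne_zero |>.1 h₄)),
      sub_eq_zero.1 (norm_eq_zero.1 (pow_eq_zero_iff two_ne_zero |>.1 h₅))⟩
  · rintro ⟨rfl, rfl⟩
    refine ⟨hfeas, fun x' u' h' ↦ ?_⟩
    rw [isFeasible_iff] at h'
    have := h.cost_add_le htf hα hc hU huref h'.1 h'.2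
    have h₃ : 0 ≤ 1 / 2 * ‖x' - w.1‖ ^ 2 +
      α / 2 * ‖u' - reducedControl tf α B uref (controlSet tf U) w.2.1‖ ^ 2 := by positivity
    linarith

theorem IsOptimalitySolution.unique (htf : 0 < tf) (hα : 0 < α) (hc : IsClosed U)
    (hU : Convex ℝ U) (huref : uref ∈ U) {w w' : W tf n}
    (h : IsOptimalitySolution tf α xref uref A B U x₀ w)
    (h' : IsOptimalitySolution tf α xref uref A B U x₀ w') : w = w' := by
  have hx : w.1 = w'.1 := ((h'.isOptimal_iff htf hα hc hU huref).1
    ((h.isOptimal_iff htf hα hc hU huref).2 ⟨rfl, rfl⟩)).1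
  have hl : w.2.1 = w'.2.1 := by
    refine sub_eq_zero.1 (eq_zero_of_isWeakDeriv_compLp htf (-A.adjoint) ?_
      (.inr (by simpa using h.terminal.sub h'.terminal)))
    have := h.costate.sub h'.costate
    rwa [hx, add_sub_add_right_eq_sub, ← ContinuousLinearMap.compLp_sub'] at this
  have hl₀ : w.2.2 = w'.2.2 :=
    h.initial.unique htf (left_mem_Icc.2 htf.le) (hl ▸ h'.initial)
  exact Prod.ext hx (Prod.ext hl hl₀)

/-- Existence: a scaled Hilbert space norm turns the optimal control problem into the projection
of `(xref, √α uref)` onto a closed convex set, and the adjoint equation turns the variational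
inequality of that projection into the optimality system. -/
theorem exists_isOptimalitySolution (htf : 0 < tf) (hα : 0 < α) (hc : IsClosed U)
    (hU : Convex ℝ U) (huref : uref ∈ U) (x₀ : E n) :
    ∃ w : W tf n, IsOptimalitySolution tf α xref uref A B U x₀ w := by
  set X := Lp.const 2 (horizon tf) xref
  set Y := Lp.const 2 (horizon tf) uref
  have hs : 0 < √α := Real.sqrt_pos.2 hα
  have hss : ∀ u : L2 tf m, (√α)⁻¹ • √α • u = u := fun u ↦ inv_smul_smul₀ hs.ne' u
  -- the second component is `√α • u`, so that the squared norm carries the weight `α` of the cost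
  let K : Set (WithLp 2 (L2 tf n × L2 tf m)) :=
    {p | IsTrajectory tf A B x₀ p.fst ((√α)⁻¹ • p.snd) ∧ (√α)⁻¹ • p.snd ∈ controlSet tf U}
  have hKmem : ∀ {x u}, IsTrajectory tf A B x₀ x u → u ∈ controlSet tf U →
      WithLp.toLp 2 (x, √α • u) ∈ K := fun hx hu ↦ by
    simpa [K, hss] using ⟨hx, hu⟩
  have hKne : K.Nonempty := by
    obtain ⟨x, hx⟩ := exists_isTrajectory htf A B x₀ Y
    exact ⟨_, hKmem hx (const_mem_controlSet huref)⟩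
  have hKclosed : IsClosed K := by
    refine ((isClosed_setOf_isTrajectory htf A B x₀).preimage
      (f := fun p : WithLp 2 (L2 tf n × L2 tf m) ↦ (p.fst, (√α)⁻¹ • p.snd)) ?_).inter
      ((isClosed_controlSet hc).preimage (f := fun p : WithLp 2 (L2 tf n × L2 tf m) ↦
        (√α)⁻¹ • p.snd) ?_) <;> fun_prop
  have hKconv : Convex ℝ K := by
    rintro p ⟨hp, hp'⟩ q ⟨hq, hq'⟩ a b ha hb hab
    have hsnd : (√α)⁻¹ • (a • p + b • q).snd = a • (√α)⁻¹ • p.snd + b • (√α)⁻¹ • q.snd := by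
      simp only [WithLp.add_snd, WithLp.smul_snd, smul_add, smul_comm (√α)⁻¹]
    constructor
    · have := (hp.const_smul a).add (hq.const_smul b)
      rwa [← add_smul, hab, one_smul, ← hsnd] at this
    · rw [hsnd]
      exact convex_controlSet hU hp' hq' ha hb hab
  obtain ⟨⟨hxu, hu⟩, hmin⟩ := proj_spec hKconv hKclosed hKne (WithLp.toLp 2 (X, √α • Y))
  set p := proj K (WithLp.toLp 2 (X, √α • Y))
  set x := p.fst
  set u := (√α)⁻¹ • p.snd
  have hpu : p.snd = √α • u := (smul_inv_smul₀ hs.ne' _).symm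
  obtain ⟨l, hl, hl₁⟩ := exists_isWeakDeriv_compLp_add htf (-A.adjoint) (x - X) tf 0
  obtain ⟨l₀, hl₀⟩ := hl.exists_hasPointValue htf 0
  have hred : reducedControl tf α B uref (controlSet tf U) l = u := by
    refine reducedControl_eq_of_inner_le hα hu fun v hv ↦ ?_
    obtain ⟨y, hy⟩ := exists_isTrajectory htf A B x₀ v
    have h₁ := hmin _ (hKmem hy hv)
    have h₂ := (hy.sub hxu).inner_eq htf hl hl₀ hl₁
    rw [sub_self, inner_zero_left, sub_zero] at h₂
    rw [WithLp.prod_inner_apply] at h₁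
    change inner ℝ (X - x) (y - x) + inner ℝ (√α • Y - p.snd) (√α • v - p.snd) ≤ 0 at h₁
    rw [hpu, ← smul_sub, ← smul_sub, real_inner_smul_left, real_inner_smul_right, ← mul_assoc,
      Real.mul_self_sqrt hα.le, ← neg_sub x X, ← neg_sub u Y, inner_neg_left, inner_neg_left,
      real_inner_comm, real_inner_comm (v - u)] at h₁
    linarith
  exact ⟨(x, l, l₀), ⟨by rw [hred]; exact hxu, hl, hl₀, hl₁⟩⟩

end OptimalControl

/-! ### The splitting scheme and the MPC algorithm -/

section Scheme

variable {n m : ℕ} {tf α h : ℝ} {xref : E n} {uref : E m} {Mp : E n → E n}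
  {Bp B : E m →L[ℝ] E n} {A : E n →L[ℝ] E n} {U : Set (E m)}

theorem existsUnique_mem_Mopt (htf : 0 < tf) (hα : 0 < α) (hc : IsClosed U) (hU : Convex ℝ U)
    (huref : uref ∈ U) (x₀ : E n) :
    ∃! w, (w, -embed tf x₀) ∈ Mopt tf α xref uref A B (controlSet tf U) 0 := by
  simp only [mem_Mopt_iff]
  obtain ⟨w, hw⟩ :=
    exists_isOptimalitySolution (A := A) (B := B) (xref := xref) htf hα hc hU huref x₀
  exact ⟨w, hw, fun w' hw' ↦ hw'.unique htf hα hc hU huref hw⟩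

/-- The consistent states are those whose optimizer part solves the optimality system. -/
theorem mem_opDom_M0_iff {v : V tf n} : v ∈ opDom (M0 tf α xref uref Mp Bp A B U) ↔
    IsOptimalitySolution tf α xref uref A B U v.1 v.2 := by
  rw [← mem_Mopt_iff]
  constructor
  · rintro ⟨y, -, z, hz, h0⟩
    rwa [eq_neg_of_add_eq_zero_left h0.symm] at hz
  · intro hv
    exact ⟨(Mp v.1 - Bp (feedback α B uref U v.2.2.2), 0), rfl, _, hv, (neg_add_cancel _).symm⟩

theorem resolve_mem_opDom_M0 (htf : 0 < tf) (hα : 0 < α) (hc : IsClosed U) (hU : Convex ℝ U)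
    (huref : uref ∈ U) (v : V tf n) :
    resolve tf α xref uref A B (controlSet tf U) v ∈ opDom (M0 tf α xref uref Mp Bp A B U) := by
  rw [mem_opDom_M0_iff, ← mem_Mopt_iff]
  exact Classical.epsilon_spec (existsUnique_mem_Mopt htf hα hc hU huref v.1).exists

/-- The flow of the plant part performs the plant step of the MPC algorithm. -/
theorem IsFlow.exists_strongSolution_eq_iff (hMp : IsMaximallyMonotone (opGraph Mp)) (hh : 0 < h)
    {φ : ℝ → V tf n → V tf n} (hφ : IsFlow (F1 tf α uref Mp Bp B U) φ) (v : V tf n) (y : E n) :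
    (∃ x : ℝ → E n,
      IsStrongSolutionOn (fun _ ξ ↦ -Mp ξ + Bp (feedback α B uref U v.2.2.2)) h v.1 x ∧ y = x h) ↔
      y = (φ h v).1 := by
  have hsol := ((isStrongSolutionOn_F1_iff hh).1 (hφ v h hh)).1
  constructor
  · rintro ⟨x, hx, rfl⟩
    exact hx.eqOn_of_dissipative (hMp.dissipative _) hsol (right_mem_Icc.2 hh.le)
  · exact fun hy ↦ ⟨_, hsol, hy⟩

end Scheme

theorem mainTheorem4 {n m : ℕ} (tf α h : ℝ) (htf : 0 < tf) (hα : 0 < α) (hh : 0 < h)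
    (Mp : E n → E n) (hMp : IsMaximallyMonotone (opGraph Mp)) (Bp : E m →L[ℝ] E n)
    (A : E n →L[ℝ] E n) (B : E m →L[ℝ] E n) (xref : E n) (uref : E m)
    (U : Set (E m)) (hUclosed : IsClosed U) (hUconvex : Convex ℝ U) (huref : uref ∈ U) :
    -- the flow of the plant part exists and is unique
    (∃ φ, IsFlow (F1 tf α uref Mp Bp B U) φ) ∧
    (∀ φ φ', IsFlow (F1 tf α uref Mp Bp B U) φ → IsFlow (F1 tf α uref Mp Bp B U) φ' →
      ∀ t ≥ 0, φ t = φ' t) ∧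
    -- the algebraic constraint is uniquely solvable
    (∀ x₀ : E n, ∃! w, (w, -embed tf x₀) ∈ Mopt tf α xref uref A B (controlSet tf U) 0) ∧
    -- the splitting scheme is MPC
    ∀ φ, IsFlow (F1 tf α uref Mp Bp B U) φ →
      ∀ v : ℕ → V tf n,
        (∀ k, v (k + 1) = resolve tf α xref uref A B (controlSet tf U) (φ h (v k))) →
        (∀ k, v (k + 1) ∈ opDom (M0 tf α xref uref Mp Bp A B U)) ∧
        (v 0 ∈ opDom (M0 tf α xref uref Mp Bp A B U) →
          ∀ (xp : ℕ → E n) (xs : ℕ → L2 tf n) (us : ℕ → L2 tf m) (up : ℕ → E m),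
            xp 0 = (v 0).1 →
            (IsMPCRun tf α h xref uref (fun x => -Mp x) Bp A B (controlSet tf U) xp xs us up ↔
              ∀ k, xp k = (v k).1 ∧ xs k = (v k).2.1 ∧
                us k = reducedControl tf α B uref (controlSet tf U) (v k).2.2.1 ∧
                up k = feedback α B uref U (v k).2.2.2)) := by
  refine ⟨exists_isFlow_F1 hMp, fun φ φ' hφ hφ' t ht ↦ hφ.F1_unique hMp hφ' ht,
    existsUnique_mem_Mopt htf hα hUclosed hUconvex huref, fun φ hφ v hv ↦ ?_⟩
  have hcons : ∀ k, v (k + 1) ∈ opDom (M0 tf α xref uref Mp Bp A B U) := fun k ↦ by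
    rw [hv k]
    exact resolve_mem_opDom_M0 htf hα hUclosed hUconvex huref _
  refine ⟨hcons, fun hv₀ xp xs us up hxp₀ ↦ ?_⟩
  have hopt : ∀ k, IsOptimalitySolution tf α xref uref A B U (v k).1 (v k).2 := fun k ↦
    mem_opDom_M0_iff.1 (k.casesOn hv₀ hcons)
  have hnext : ∀ k, (v (k + 1)).1 = (φ h (v k)).1 := fun k ↦ by rw [hv k]; rfl
  have hval : ∀ k, HasPointValue tf (reducedControl tf α B uref (controlSet tf U) (v k).2.2.1) 0
      (feedback α B uref U (v k).2.2.2) := fun k ↦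
    hasPointValue_reducedControl hUclosed hUconvex huref (hopt k).initial
  constructor
  · intro hrun
    have hk : ∀ k, xp k = (v k).1 → xs k = (v k).2.1 ∧
        us k = reducedControl tf α B uref (controlSet tf U) (v k).2.2.1 ∧
        up k = feedback α B uref U (v k).2.2.2 := by
      intro k hxp
      obtain ⟨hxs, hus⟩ := ((hopt k).isOptimal_iff htf hα hUclosed hUconvex huref).1
        (hxp ▸ hrun.optimal k)
      exact ⟨hxs, hus, (hrun.input k).unique htf (left_mem_Icc.2 htf.le) (hus ▸ hval k)⟩
    have hxp : ∀ k, xp k = (v k).1 := by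
      intro k
      induction k with
      | zero => exact hxp₀
      | succ k ih =>
        rw [hnext k]
        refine (hφ.exists_strongSolution_eq_iff hMp hh (v k) _).1 ?_
        have := hrun.step k
        rwa [(hk k ih).2.2, ih] at this
    exact fun k ↦ ⟨hxp k, hk k (hxp k)⟩
  · intro hall
    refine ⟨fun k ↦ ?_, fun k ↦ ?_, fun k ↦ ?_⟩
    · obtain ⟨h₁, h₂, h₃, -⟩ := hall k
      rw [h₁]
      exact ((hopt k).isOptimal_iff htf hα hUclosed hUconvex huref).2 ⟨h₂, h₃⟩
    · obtain ⟨-, -, h₃, h₄⟩ := hall k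
      rw [h₃, h₄]
      exact hval k
    · rw [(hall k).1, (hall k).2.2.2, (hall (k + 1)).1]
      exact (hφ.exists_strongSolution_eq_iff hMp hh (v k) _).2 (hnext k)
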